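/- Let $d,e\ge 2$, let $X=\mathbb{P}^1\times\mathbb{P}^1$ over $\mathbb{C}$ with homogeneous coordinates $(x_0:x_1)$, $(y_0:y_1)$, and let $S_{a,b}=H^0(X,\mathcal{O}_X(a,b))$ be the space of polynomials of bidegree $(a,b)$. Let $F\in S_{d,e}$ be irreducible and such that the curve $Z=\{F=0\}\subset X$ is smooth, i.e. the four partial derivatives of $F$ have no common zero on $Z$. Put $L=\mathcal{O}_X(d,e)$ and let $\Sigma_L$ be the bundle of differential operators of order at most one on sections of $L$. For $M=\mathcal{O}_X(a,b)$ let $$J_{a,b}=\operatorname{im}\bigl(dF\colon H^0(X,\Sigma_L\otimes L^{\vee}\otimes M)\to H^0(X,M)=S_{a,b}\bigr),\qquad D\mapsto D(F),$$ be the generalized Jacobian ideal of $F$ in degree $(a,b)$, let $J_{a,b|Z}$ be the space of restrictions to $Z$ of the elements of $J_{a,b}$, and let $|J_{a,b|Z}|$ be the corresponding linear system on $Z$. Then: 1. The base divisor $R$ of $|J_{d-1,e|Z}|$ (its largest fixed effective divisor) is equal to the ramification divisor $\sum_{p\in Z}(e_p-1)\,p$ of the second projection $Z\hookrightarrow X\to\mathbb{P}^1$,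 where $e_p$ denotes the ramification index at $p$. After removing $R$ the linear system induces the projection of $Z$ onto the first factor: there is a linear isomorphism $\theta\colon\mathbb{C}^2\to (J_{d-1,e|Z})^{*}$ such that the map $Z\to|J_{d-1,e|Z}|^{\vee}=\mathbb{P}\bigl((J_{d-1,e|Z})^{*}\bigr)$ that sends $p$ to the hyperplane $\{s : s=0 \text{ or } \operatorname{div}(s)-R\ge p\}$ is the composition of the first projection $Z\to\mathbb{P}^1$ with the isomorphism $\mathbb{P}^1\to|J_{d-1,e|Z}|^{\vee}$ given by $\theta$. 2. The linear system $|J_{d,e|Z}|$ is base point free, and the induced map $Z\to|J_{d,e|Z}|^{\vee}$, $p\mapsto\{s : s(p)=0\}$, is a morphism that is birational onto its image. -/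

import Mathlib

/-!
Curves in `ℙ¹ × ℙ¹` over `ℂ`, classical (closed point) language.  Index `Sum.inl i` stands for the
coordinate `x_i` of the first factor, `Sum.inr j` for the coordinate `y_j` of the second factor.
-/

namespace BiProj

open MvPolynomial LinearAlgebra.Projectivization Module

/-- The index set of the coordinates `x₀, x₁, y₀, y₁`. -/
abbrev Idx : Type := Fin 2 ⊕ Fin 2

/-- The bihomogeneous coordinate ring `S = ℂ[x₀, x₁, y₀, y₁]`. -/
abbrev S : Type := MvPolynomial Idx ℂ

/-- `deg x_i = (1, 0)` and `deg y_j = (0, 1)`. -/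
def bideg : Idx → ℕ × ℕ := Sum.elim (fun _ => (1, 0)) (fun _ => (0, 1))

/-- `bigraded (a, b)` is the space `S_{a,b}` of polynomials of bidegree `(a, b)`, that is, the space
of global sections of `𝒪(a, b)`. -/
noncomputable abbrev bigraded : ℕ × ℕ → Submodule ℂ S := weightedHomogeneousSubmodule ℂ bideg

noncomputable instance : GradedAlgebra bigraded := weightedGradedAlgebra ℂ bideg

/-- The projective line. -/
abbrev P1 : Type := ℙ ℂ (Fin 2 → ℂ)

/-- The surface `X = ℙ¹ × ℙ¹`. -/
abbrev Surf : Type := P1 × P1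

/-- Bihomogeneous coordinates of a point (well defined up to a nonzero factor in each block). -/
noncomputable def coords (p : Surf) : Idx → ℂ := Sum.elim p.1.rep p.2.rep

/-- Evaluation of polynomials at the chosen coordinates of a point. -/
noncomputable def evalAt (p : Surf) : S →ₐ[ℂ] ℂ := aeval (coords p)

/-- The set of points of `{F = 0}`, for `F` bihomogeneous. -/
def Z (F : S) : Set Surf := {p | evalAt p F = 0}

/-- The curve `{F = 0}`, for `F` bihomogeneous of positive degrees, is smooth: the four partial
derivatives do not vanish simultaneously at any of its points. -/
def IsSmooth (F : S) : Prop := ∀ p ∈ Z F, ∃ s : Idx, evalAt p (pderiv s F) ≠ 0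

/-! ### First order differential operators and generalized Jacobian ideals

`U_{ij}` denotes the affine chart `x_i ≠ 0, y_j ≠ 0` of `X`.  The intersection of the four charts
is the torus where all coordinates are nonzero.  Sections over `U_{ij}` of line bundles and of the
bundles below are determined by their restrictions to the torus, and are described there by Laurent
polynomials. -/

/-- Laurent polynomials in `x₀, x₁, y₀, y₁`. -/
abbrev Laurent : Type := AddMonoidAlgebra ℂ (Idx → ℤ)

/-- The variable with index `s` as a Laurent polynomial. -/
noncomputable def lvar (s : Idx) : Laurent := AddMonoidAlgebra.single (Pi.single s 1) 1

/-- The inclusion of the polynomials into the Laurent polynomials. -/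
noncomputable def toLaurent : S →ₐ[ℂ] Laurent := aeval lvar

/-- The partial derivative with respect to the variable `s`:
`c • t^m ↦ (m s * c) • t^(m - e_s)`. -/
noncomputable def lderiv (s : Idx) : Laurent →ₗ[ℂ] Laurent :=
  (Finsupp.lsum ℂ fun m : Idx → ℤ =>
    (AddMonoidAlgebra.lsingle (m - Pi.single s 1) : ℂ →ₗ[ℂ] Laurent).comp
      (LinearMap.lsmul ℂ ℂ (m s : ℂ))).comp
    (AddMonoidAlgebra.coeffLinearEquiv ℂ).toLinearMap

/-- Sections of `𝒪(m, n)` over the torus. -/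
noncomputable def torusSections (m n : ℤ) : Submodule ℂ Laurent :=
  AddMonoidAlgebra.supported ℂ ℂ
    {u | u (Sum.inl 0) + u (Sum.inl 1) = m ∧ u (Sum.inr 0) + u (Sum.inr 1) = n}

/-- Sections of `𝒪(m, n)` over the chart `U_{ij}`: only `x_i` and `y_j` may occur with negative
exponents. -/
noncomputable def chartSections (i j : Fin 2) (m n : ℤ) : Submodule ℂ Laurent :=
  AddMonoidAlgebra.supported ℂ ℂ
    {u | (u (Sum.inl 0) + u (Sum.inl 1) = m ∧ u (Sum.inr 0) + u (Sum.inr 1) = n) ∧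
      0 ≤ u (Sum.inl (1 - i)) ∧ 0 ≤ u (Sum.inr (1 - j))}

/-- The differential operator `σ ↦ A σ + B D_z σ + C D_w σ`, acting on the sections of
`L = 𝒪(d, e)`.  In the coordinates `z = x_{1-i} / x_i`, `w = y_{1-j} / y_j` of `U_{ij}` and the
trivialization `x_i ^ d y_j ^ e` of `L`, the operators `D_z` and `D_w` are `∂/∂z` and `∂/∂w`. -/
noncomputable def chartOp (d e : ℤ) (i j : Fin 2) (A B C : Laurent) :
    torusSections d e →ₗ[ℂ] Laurent :=
  (LinearMap.mulLeft ℂ A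
    + (LinearMap.mulLeft ℂ (B * lvar (Sum.inl i))).comp (lderiv (Sum.inl (1 - i)))
    + (LinearMap.mulLeft ℂ (C * lvar (Sum.inr j))).comp (lderiv (Sum.inr (1 - j)))).comp
    (torusSections d e).subtype

/-- The space `H⁰(X, Σ_L ⊗ L^∨ ⊗ M)`, where `L = 𝒪(d, e)`, `M ⊗ L^∨ = 𝒪(m, n)` and `Σ_L` is the
bundle of differential operators of order at most one on sections of `L`: operators that on each
chart `U_{ij}` are of the form `A + B D_z + C D_w`, with `A, B, C` sections of `M ⊗ L^∨`
over `U_{ij}`. -/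
noncomputable def globalOps (d e m n : ℤ) : Submodule ℂ (torusSections d e →ₗ[ℂ] Laurent) where
  carrier := {D | ∀ i j : Fin 2, ∃ A ∈ chartSections i j m n, ∃ B ∈ chartSections i j m n,
    ∃ C ∈ chartSections i j m n, D = chartOp d e i j A B C}
  add_mem' := by
    intro D D' h h' i j
    obtain ⟨A, hA, B, hB, C, hC, rfl⟩ := h i j
    obtain ⟨A', hA', B', hB', C', hC', rfl⟩ := h' i j
    refine ⟨A + A', add_mem hA hA', B + B', add_mem hB hB', C + C', add_mem hC hC', ?_⟩
    ext σ : 1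
    simp only [chartOp, LinearMap.add_apply, LinearMap.comp_apply, LinearMap.mulLeft_apply]
    ring
  zero_mem' := by
    intro i j
    refine ⟨0, zero_mem _, 0, zero_mem _, 0, zero_mem _, ?_⟩
    ext σ : 1
    simp [chartOp]
  smul_mem' := by
    intro c D h i j
    obtain ⟨A, hA, B, hB, C, hC, rfl⟩ := h i j
    refine ⟨c • A, Submodule.smul_mem _ c hA, c • B, Submodule.smul_mem _ c hB,
      c • C, Submodule.smul_mem _ c hC, ?_⟩
    ext σ : 1
    simp only [chartOp, LinearMap.add_apply, LinearMap.comp_apply, LinearMap.mulLeft_apply,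
      LinearMap.smul_apply, smul_add, smul_mul_assoc]

theorem toLaurent_monomial (u : Idx →₀ ℕ) (c : ℂ) :
    toLaurent (monomial u c) = AddMonoidAlgebra.single (fun s => (u s : ℤ)) c := by
  have h : ∀ (v : Idx → ℕ) (t : Finset Idx), ∏ s ∈ t, lvar s ^ v s =
      AddMonoidAlgebra.single (∑ s ∈ t, v s • (Pi.single s (1 : ℤ) : Idx → ℤ)) (1 : ℂ) := by
    intro v t
    induction t using Finset.induction_on with
    | empty => simp [AddMonoidAlgebra.one_def]
    | insert s t hs ih =>
      rw [Finset.prod_insert hs, Finset.sum_insert hs, ih, lvar, AddMonoidAlgebra.single_pow,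
        AddMonoidAlgebra.single_mul_single]
      simp
  have h2 : ∑ s : Idx, u s • (Pi.single s (1 : ℤ) : Idx → ℤ) = fun s => (u s : ℤ) := by
    funext s
    simp [Finset.sum_apply, Pi.single_apply]
  rw [toLaurent, aeval_monomial, Finsupp.prod_fintype _ _ (by simp), h u Finset.univ, h2,
    ← Algebra.smul_def, AddMonoidAlgebra.smul_single, smul_eq_mul, mul_one]

theorem toLaurent_mem {d e : ℕ} (G : bigraded (d, e)) :
    toLaurent (G : S) ∈ torusSections (d : ℤ) (e : ℤ) := by
  rw [(G : S).as_sum, map_sum]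
  refine Submodule.sum_mem _ fun u hu => ?_
  have hw := G.2 (mem_support_iff.mp hu)
  rw [Finsupp.weight_apply, Finsupp.sum_fintype _ _ (by simp)] at hw
  simp only [Fintype.sum_sum_type, Fin.sum_univ_two, bideg, Sum.elim_inl, Sum.elim_inr,
    Prod.smul_mk, smul_eq_mul, mul_one, mul_zero, Prod.mk_add_mk, Prod.mk.injEq] at hw
  rw [toLaurent_monomial, torusSections, AddMonoidAlgebra.mem_supported]
  refine (Finset.coe_subset.mpr Finsupp.support_single_subset).trans ?_
  simp only [Finset.coe_singleton, Set.singleton_subset_iff, Set.mem_ofPred_eq]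
  omega

/-- A polynomial of bidegree `(d, e)` as a section of `𝒪(d, e)`. -/
noncomputable def asSection {d e : ℕ} (G : bigraded (d, e)) : torusSections (d : ℤ) (e : ℤ) :=
  ⟨toLaurent (G : S), toLaurent_mem G⟩

/-- The generalized Jacobian ideal of `F ∈ H⁰(L)`, `L = 𝒪(d, e)`, in degree `M = 𝒪(a, b)`: the
image `J_{a,b} ⊆ H⁰(M) = S_{a,b}` of `dF : H⁰(Σ_L ⊗ L^∨ ⊗ M) → H⁰(M)`, `D ↦ D(F)`. -/
noncomputable def jacobian {d e : ℕ} (F : bigraded (d, e)) (a b : ℕ) : Submodule ℂ S :=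
  bigraded (a, b) ⊓
    ((globalOps d e ((a : ℤ) - d) ((b : ℤ) - e)).map
      (LinearMap.applyₗ (asSection F))).comap toLaurent.toLinearMap

/-! ### Orders of vanishing on the curve -/

/-- The prime ideal of polynomials vanishing at the chosen coordinates of `p`. -/
noncomputable abbrev primeAt (p : Surf) : Ideal S := RingHom.ker (evalAt p)

instance (p : Surf) : (primeAt p).IsPrime := RingHom.ker_isPrime (evalAt p)

/-- The local ring `𝒪_{X,p}`: fractions `G / H` with `G`, `H` of the same bidegree and
`H(p) ≠ 0`. -/
abbrev Stalk (p : Surf) : Type := HomogeneousLocalization.AtPrime bigraded (primeAt p)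

/-- The ideal of `𝒪_{X,p}` generated by the local equations `G / H` of `{G = 0}` at `p`, for `G`
bihomogeneous, where `H` has the same bidegree as `G` and `H(p) ≠ 0`. -/
noncomputable def germIdeal (p : Surf) (G : S) : Ideal (Stalk p) :=
  Ideal.span {q | ∃ c : HomogeneousLocalization.NumDenSameDeg bigraded (primeAt p).primeCompl,
    (c.num : S) = G ∧ q = HomogeneousLocalization.mk c}

/-- The local ring `𝒪_{Z,p}` of the curve `Z = {F = 0}`. -/
abbrev CurveStalk (F : S) (p : Surf) : Type := Stalk p ⧸ germIdeal p F

/-- The order of vanishing at the point `p` of `Z = {F = 0}` of the restriction to `Z` of the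
bihomogeneous polynomial `G`: the length of `𝒪_{Z,p} / (g)`, with `g` the germ of `G` in a local
trivialization. -/
noncomputable def ordAt (F : S) (p : Surf) (G : S) : ℕ∞ :=
  Module.length (CurveStalk F p)
    (CurveStalk F p ⧸ (germIdeal p G).map (Ideal.Quotient.mk (germIdeal p F)))

/-- Effective divisors on `Z = {F = 0}`, for a smooth curve `Z`. -/
abbrev EffDiv (F : S) : Type := Z F →₀ ℕ

/-- `R` is the base divisor (fixed part) of the linear system on `Z` that is cut out by the
bihomogeneous polynomials in `J` (all of the same bidegree): the largest divisor contained in the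
divisors of all its members. -/
def IsBaseDivisor (F : S) (J : Submodule ℂ S) (R : EffDiv F) : Prop :=
  ∀ p : Z F, (R p : ℕ∞) = ⨅ s ∈ J, ordAt F p s

/-- The linear form `q₀ y₁ - q₁ y₀` in the coordinates of the second factor, whose only zero is the
point `q = [q₀ : q₁]`. -/
noncomputable def lineThrough (q : P1) : S :=
  C (q.rep 0) * X (Sum.inr 1) - C (q.rep 1) * X (Sum.inr 0)

/-- The ramification index at `p ∈ Z` of the second projection `Z → ℙ¹`: the order at `p` of the
pull-back of a local parameter at the image of `p`. -/
noncomputable def ramIndexSnd (F : S) (p : Surf) : ℕ∞ := ordAt F p (lineThrough p.2)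

/-- `R` is the ramification divisor `∑ (e_p - 1) p` of the second projection `Z → ℙ¹`. -/
def IsRamificationDivisorSnd (F : S) (R : EffDiv F) : Prop :=
  ∀ p : Z F, ramIndexSnd F p = (R p : ℕ∞) + 1

/-! ### Linear systems on the curve and their maps -/

/-- Restriction of polynomials to `Z = {F = 0}`. -/
noncomputable def res (F : S) : S →ₗ[ℂ] S ⧸ Ideal.span {F} :=
  (Ideal.Quotient.mkₐ ℂ (Ideal.span {F})).toLinearMap

/-- The space `J|_Z` of restrictions to `Z = {F = 0}` of the elements of `J`. -/
noncomputable abbrev restrict (F : S) (J : Submodule ℂ S) : Submodule ℂ (S ⧸ Ideal.span {F}) :=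
  J.map (res F)

/-- The restriction of an element of `J`, as an element of `J|_Z`. -/
noncomputable def resTo (F : S) (J : Submodule ℂ S) : J →ₗ[ℂ] restrict F J :=
  (res F).submoduleMap J

/-- The linear system on `Z` given by `J` has no base points. -/
def IsBasePointFree (F : S) (J : Submodule ℂ S) : Prop :=
  ∀ p ∈ Z F, ∃ s ∈ J, evalAt p s ≠ 0

/-- `φ : Z → |J|_Z|^∨ = ℙ((J|_Z)^*)` is the map induced by the linear system `|J|_Z|` after removing
its base divisor `R`: it sends `p` to the hyperplane in `J|_Z` of those sections `s` for which
`div s - R` contains `p`.  A point of `ℙ((J|_Z)^*)` is determined by this hyperplane, so there is at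
most one such `φ`. -/
def IsInducedMap (F : S) (J : Submodule ℂ S) (R : EffDiv F)
    (φ : Z F → ℙ ℂ (Dual ℂ (restrict F J))) : Prop :=
  ∀ (p : Z F) (s : J), (φ p).rep (resTo F J s) = 0 ↔ (R p : ℕ∞) < ordAt F p s

section Maps

variable {F : S} {W : Type} [AddCommGroup W] [Module ℂ W]

/-- The value of the polynomial `P` on `W^*` (a polynomial expression in elements of `W`) at the
chosen representative of a point of `ℙ(W^*)`. -/
noncomputable def evalDual (u : ℙ ℂ (Dual ℂ W)) : MvPolynomial W ℂ →ₐ[ℂ] ℂ :=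
  aeval fun w => u.rep w

/-- A map `φ : Z → ℙ(W^*)` is a morphism: near every point of `Z` it is given by bihomogeneous
polynomials of one bidegree `n` (`Ψ w` is the coordinate belonging to `w ∈ W`) without common
zero. -/
def IsMorphism (φ : Z F → ℙ ℂ (Dual ℂ W)) : Prop :=
  ∀ p : Z F, ∃ (n : ℕ × ℕ) (Ψ : W →ₗ[ℂ] S), (∀ w, Ψ w ∈ bigraded n) ∧
    (evalAt p).toLinearMap.comp Ψ ≠ 0 ∧
    ∀ (q : Z F) (h : (evalAt q).toLinearMap.comp Ψ ≠ 0),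
      φ q = Projectivization.mk ℂ ((evalAt q).toLinearMap.comp Ψ) h

/-- A map to `ℙ¹` is regular on the subset `V` of `ℙ(W^*)`: near every point of `V` it is given by
two homogeneous polynomials of one degree `m` without common zero. -/
def IsRegularOn (V : Set (ℙ ℂ (Dual ℂ W))) (g : ℙ ℂ (Dual ℂ W) → P1) : Prop :=
  ∀ v ∈ V, ∃ (m : ℕ) (P : Fin 2 → MvPolynomial W ℂ), (∀ k, (P k).IsHomogeneous m) ∧
    (fun k => evalDual v (P k)) ≠ 0 ∧
    ∀ u ∈ V, ∀ h : (fun k => evalDual u (P k)) ≠ 0,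
      g u = Projectivization.mk ℂ (fun k => evalDual u (P k)) h

/-- `V` is a Zariski open subset of the subset `Y` of `ℙ(W^*)`. -/
def IsZariskiOpenIn (Y V : Set (ℙ ℂ (Dual ℂ W))) : Prop :=
  ∃ T : Set (MvPolynomial W ℂ), (∀ P ∈ T, ∃ m : ℕ, P.IsHomogeneous m) ∧
    V = {u ∈ Y | ∃ P ∈ T, evalDual u P ≠ 0}

/-- A map `φ : Z → ℙ(W^*)` from an irreducible curve is a morphism that is birational onto its
image: it restricts to an isomorphism `φ⁻¹(V) → V` for a nonempty Zariski open subset `V` of the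
image, the inverse being `ψ`. -/
def IsBirationalOntoImage (φ : Z F → ℙ ℂ (Dual ℂ W)) : Prop :=
  IsMorphism φ ∧ ∃ V : Set (ℙ ℂ (Dual ℂ W)), IsZariskiOpenIn (Set.range φ) V ∧ V.Nonempty ∧
    ∃ ψ : ℙ ℂ (Dual ℂ W) → Surf, IsRegularOn V (fun u => (ψ u).1) ∧
      IsRegularOn V (fun u => (ψ u).2) ∧ ∀ p : Z F, φ p ∈ V → ψ (φ p) = p

end Maps

end BiProj

open BiProj

/-!
Near a point `p` of `Z = {F = 0}` all orders of vanishing are read off from one formal arc. A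
vector field `D = F_t ∂_s - F_s ∂_t` on affine 4-space kills `F`, so its formal flow `exp(T D)`,
evaluated at the coordinates of `p`, is a homomorphism `Φ : S → ℂ⟦T⟧` with `Φ F = 0` and
`(Φ G)' = Φ (D G)` (`integralCurve`).
Take for `s`, `t` the affine coordinates of a chart around `p`.
Smoothness makes one of the two linear forms through `p` a generator of the maximal ideal of
`𝒪_{Z,p}` whose image under `Φ` has order one, so that `ordAt F p G = ord_T (Φ G)` for every
bihomogeneous `G` (`exists_parametrization`). This order is finite unless `F ∣ G`: the kernel of a
bihomogeneous version of `Φ` is a prime strictly below the prime of the cone over `p`, and a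
dimension count shows that no such prime contains both `F` and a polynomial that `F` does not
divide (`eq_conePrime`). The same count shows that `F` and `G` have finitely many common zeros
(`finite_common_zeros`).

For the first part, comparison of the coefficients of a global operator on the four charts shows
that `J_{d-1,e}` is spanned by `F_{x₀}` and `F_{x₁}` (`jacobian_inl_eq_span`). By Euler's relation,
`x_i (c₀ F_{x₀} + c₁ F_{x₁}) ≡ ± (c₁ x₀ - c₀ x₁) F_{x_{1-i}}` modulo `F`. Hence the fixed part at a
point with `x_i ≠ 0` is the order of `F_{x_{1-i}}`, and the moving part is the pencil of linear
forms in `x₀`, `x₁`, which gives the first projection. The linear form `ℓ` in `y₀`, `y₁` vanishing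
at `p` satisfies `(Φ ℓ)' = Φ (D ℓ)`, a nonzero constant times `Φ (F_{x_{1-i}})`, so that its order,
the ramification index, is `ord F_{x_{1-i}} + 1` (`exists_ordAt_pderivComb`).

For the second part, `J_{d,e}` contains all `x_k F_{x_l}` and `y_k F_{y_l}`. By smoothness they
have no common zero on `Z`, and where some `F_{x_l}` and some `F_{y_m}` are nonzero the ratios
`x₀ F_{x_l} : x₁ F_{x_l}` and `y₀ F_{y_m} : y₁ F_{y_m}` recover the point
(`isBirationalOntoImage_mk_evalRestrict`).
-/

/-! ### Lengths over a local ring with a formal arc -/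

open IsLocalRing in
/-- A homomorphism to `ℂ⟦T⟧` that sends a generator of the maximal ideal to a series of order one
measures divisibility by powers of that generator; neither noetherian nor domain hypotheses on `A`
are needed. -/
theorem mem_span_pow_iff_le_order {A : Type*} [CommRing A] [IsLocalRing A] {t : A}
    (ht : maximalIdeal A = Ideal.span {t}) {f : A →+* PowerSeries ℂ} (hf : (f t).order = 1)
    (n : ℕ) (a : A) : a ∈ Ideal.span {t ^ n} ↔ (n : ℕ∞) ≤ (f a).order := by
  constructor
  · rintro h
    obtain ⟨b, rfl⟩ := Ideal.mem_span_singleton.mp h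
    rw [map_mul, map_pow, PowerSeries.order_mul, PowerSeries.order_pow, hf]
    simp
  · induction n generalizing a with
    | zero => simp
    | succ n ih =>
      intro h
      have ha : a ∈ maximalIdeal A := by
        by_contra hu
        rw [mem_maximalIdeal, mem_nonunits_iff, not_not] at hu
        rw [PowerSeries.order_zero_of_unit (hu.map f)] at h
        simp at h
      rw [ht] at ha
      obtain ⟨b, rfl⟩ := Ideal.mem_span_singleton.mp ha
      rw [map_mul, PowerSeries.order_mul, hf, Nat.cast_succ, add_comm] at h
      obtain ⟨c, hc⟩ := Ideal.mem_span_singleton.mp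
        (ih b ((ENat.add_le_add_iff_left (by simp)).mp h))
      rw [Ideal.mem_span_singleton]
      exact ⟨c, by rw [hc]; ring⟩

open IsLocalRing in
theorem length_quotient_span_pow {A : Type*} [CommRing A] [IsLocalRing A] {t : A}
    (ht : maximalIdeal A = Ideal.span {t}) {f : A →+* PowerSeries ℂ} (hf : (f t).order = 1)
    (n : ℕ) : Module.length A (A ⧸ Ideal.span {t ^ n}) = n := by
  induction n with
  | zero =>
    rw [Nat.cast_zero, Module.length_eq_zero_iff, Ideal.Quotient.subsingleton_iff]
    simp
  | succ n ih =>
    let μ : A ⧸ Ideal.span {t ^ n} →ₗ[A] A ⧸ Ideal.span {t ^ (n + 1)} :=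
      Submodule.mapQ _ _ (LinearMap.mulLeft A t) (by
        intro a ha
        obtain ⟨b, rfl⟩ := Ideal.mem_span_singleton.mp ha
        exact Ideal.mem_span_singleton.mpr ⟨b, by simp; ring⟩)
    let π : A ⧸ Ideal.span {t ^ (n + 1)} →ₗ[A] A ⧸ maximalIdeal A :=
      Submodule.mapQ _ _ LinearMap.id (by
        intro a ha
        obtain ⟨b, rfl⟩ := Ideal.mem_span_singleton.mp ha
        rw [Submodule.mem_comap, ht]
        exact Ideal.mem_span_singleton.mpr ⟨t ^ n * b, by simp; ring⟩)
    have hμ : Function.Injective μ := by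
      rw [injective_iff_map_eq_zero]
      intro x hx
      obtain ⟨a, rfl⟩ := Submodule.Quotient.mk_surjective _ x
      have h1 : t * a ∈ Ideal.span {t ^ (n + 1)} := (Submodule.Quotient.mk_eq_zero _).mp hx
      refine (Submodule.Quotient.mk_eq_zero _).mpr ?_
      rw [mem_span_pow_iff_le_order ht hf, map_mul, PowerSeries.order_mul, hf, Nat.cast_succ,
        add_comm] at h1
      exact (mem_span_pow_iff_le_order ht hf n a).mpr ((ENat.add_le_add_iff_left (by simp)).mp h1)
    have hπ : Function.Surjective π := by
      intro x
      obtain ⟨a, rfl⟩ := Submodule.Quotient.mk_surjective _ x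
      exact ⟨Submodule.Quotient.mk a, rfl⟩
    have hex : Function.Exact μ π := by
      intro x
      obtain ⟨a, rfl⟩ := Submodule.Quotient.mk_surjective _ x
      constructor
      · intro h
        have h1 : a ∈ maximalIdeal A := (Submodule.Quotient.mk_eq_zero _).mp h
        rw [ht] at h1
        obtain ⟨b, rfl⟩ := Ideal.mem_span_singleton.mp h1
        exact ⟨Submodule.Quotient.mk b, rfl⟩
      · rintro ⟨y, hy⟩
        obtain ⟨b, rfl⟩ := Submodule.Quotient.mk_surjective _ y
        rw [← hy]
        refine (Submodule.Quotient.mk_eq_zero _).mpr ?_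
        rw [ht]
        exact Ideal.mem_span_singleton.mpr ⟨b, rfl⟩
    have hs : IsSimpleModule A (A ⧸ maximalIdeal A) :=
      isSimpleModule_iff_isCoatom.mpr (maximalIdeal.isMaximal A).out
    rw [Module.length_eq_add_of_exact μ π hμ hπ hex, ih, Module.length_eq_one]
    simp

open IsLocalRing in
/-- The length of `A / (g)` is the order of the image of `g` along the arc, also when this order is
infinite. -/
theorem length_quotient_span_singleton {A : Type*} [CommRing A] [IsLocalRing A] {t : A}
    (ht : maximalIdeal A = Ideal.span {t}) {f : A →+* PowerSeries ℂ} (hf : (f t).order = 1)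
    (g : A) : Module.length A (A ⧸ Ideal.span {g}) = (f g).order := by
  have key (n : ℕ) : (n : ℕ∞) ≤ (f g).order → (n : ℕ∞) ≤ Module.length A (A ⧸ Ideal.span {g}) := by
    intro hn
    rw [← length_quotient_span_pow ht hf n]
    have hle : Ideal.span {g} ≤ Ideal.span {t ^ n} :=
      (Ideal.span_singleton_le_iff_mem _).mpr ((mem_span_pow_iff_le_order ht hf n g).mpr hn)
    refine Module.length_le_of_surjective
      (Submodule.mapQ (Ideal.span {g}) (Ideal.span {t ^ n}) LinearMap.id hle) ?_
    intro x
    obtain ⟨a, rfl⟩ := Submodule.Quotient.mk_surjective _ x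
    exact ⟨Submodule.Quotient.mk a, rfl⟩
  by_cases htop : (f g).order = ⊤
  · rw [htop, ENat.eq_top_iff_forall_ge]
    exact fun n => key n (htop ▸ le_top)
  · obtain ⟨n, hn⟩ := ENat.ne_top_iff_exists.mp htop
    obtain ⟨u, hu⟩ := Ideal.mem_span_singleton.mp
      ((mem_span_pow_iff_le_order ht hf n g).mpr hn.le)
    have hunit : IsUnit u := by
      by_contra hm
      have hm' : u ∈ Ideal.span {t} := ht ▸ (mem_maximalIdeal u).mpr hm
      obtain ⟨b, rfl⟩ := Ideal.mem_span_singleton.mp hm'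
      have : ((n + 1 : ℕ) : ℕ∞) ≤ (f g).order :=
        (mem_span_pow_iff_le_order ht hf _ g).mp
          (Ideal.mem_span_singleton.mpr ⟨b, by rw [hu]; ring⟩)
      rw [← hn] at this
      exact absurd (Nat.cast_le.mp this) (by omega)
    rw [hu, Ideal.span_singleton_mul_right_unit hunit, length_quotient_span_pow ht hf, ← hu, hn]

/-! ### Krull dimension -/

theorem ringKrullDim_quotient_succ_le {R : Type*} [CommRing R] {Q P : Ideal R} [Q.IsPrime]
    {r : R} (hr : r ∉ Q) (hrP : r ∈ P) (hQP : Q ≤ P) :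
    ringKrullDim (R ⧸ P) + 1 ≤ ringKrullDim (R ⧸ Q) := by
  have h0 : Ideal.Quotient.mk Q r ∈ nonZeroDivisors (R ⧸ Q) :=
    mem_nonZeroDivisors_of_ne_zero (by rwa [Ne, Ideal.Quotient.eq_zero_iff_mem])
  refine le_trans ?_ (ringKrullDim_quotient_succ_le_of_nonZeroDivisor h0)
  gcongr
  have hle : Ideal.span {Ideal.Quotient.mk Q r} ≤ RingHom.ker (Ideal.Quotient.factor hQP) := by
    rw [Ideal.span_singleton_le_iff_mem, RingHom.mem_ker, Ideal.Quotient.factor_mk,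
      Ideal.Quotient.eq_zero_iff_mem]
    exact hrP
  refine ringKrullDim_le_of_surjective (Ideal.Quotient.lift _ (Ideal.Quotient.factor hQP) hle) ?_
  intro x
  obtain ⟨a, rfl⟩ := Ideal.Quotient.mk_surjective x
  exact ⟨Ideal.Quotient.mk _ (Ideal.Quotient.mk _ a), rfl⟩

namespace BiProj

open MvPolynomial LinearAlgebra.Projectivization Module

/-! ### Bihomogeneous polynomials -/

theorem weight_bideg (u : Idx →₀ ℕ) : Finsupp.weight bideg u =
    (u (Sum.inl 0) + u (Sum.inl 1), u (Sum.inr 0) + u (Sum.inr 1)) := by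
  rw [Finsupp.weight_apply, Finsupp.sum_fintype _ _ (by simp)]
  simp [bideg, Prod.smul_mk, -nsmul_eq_mul]

theorem degree_eq_of_mem_bigraded {a b : ℕ} {G : S} (hG : G ∈ bigraded (a, b)) {u : Idx →₀ ℕ}
    (hu : coeff u G ≠ 0) :
    u (Sum.inl 0) + u (Sum.inl 1) = a ∧ u (Sum.inr 0) + u (Sum.inr 1) = b := by
  have h := hG hu
  rwa [weight_bideg, Prod.mk.injEq] at h

/-- Multiply the `x`-block of a coordinate vector by `r` and the `y`-block by `s`. -/
def scale {R : Type*} [Mul R] (r s : R) (v : Idx → R) : Idx → R :=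
  Sum.elim (fun k => r * v (Sum.inl k)) (fun k => s * v (Sum.inr k))

theorem aeval_scale {R : Type*} [CommRing R] [Algebra ℂ R] {a b : ℕ} {G : S}
    (hG : G ∈ bigraded (a, b)) (r s : R) (v : Idx → R) :
    aeval (scale r s v) G = r ^ a * s ^ b * aeval v G := by
  simp only [aeval_def, eval₂_eq', Finset.mul_sum]
  refine Finset.sum_congr rfl fun u hu => ?_
  obtain ⟨rfl, rfl⟩ := degree_eq_of_mem_bigraded hG (mem_support_iff.mp hu)
  simp [scale, mul_pow, pow_add]
  ring

theorem X_inl_mem (k : Fin 2) : (X (Sum.inl k) : S) ∈ bigraded (1, 0) :=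
  isWeightedHomogeneous_X ℂ bideg (Sum.inl k)

theorem X_inr_mem (k : Fin 2) : (X (Sum.inr k) : S) ∈ bigraded (0, 1) :=
  isWeightedHomogeneous_X ℂ bideg (Sum.inr k)

theorem pderiv_inl_mem {a b : ℕ} {G : S} (hG : G ∈ bigraded (a + 1, b)) (k : Fin 2) :
    pderiv (Sum.inl k) G ∈ bigraded (a, b) :=
  IsWeightedHomogeneous.pderiv hG rfl

theorem pderiv_inr_mem {a b : ℕ} {G : S} (hG : G ∈ bigraded (a, b + 1)) (k : Fin 2) :
    pderiv (Sum.inr k) G ∈ bigraded (a, b) :=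
  IsWeightedHomogeneous.pderiv hG rfl

theorem euler_inl {a b : ℕ} {G : S} (hG : G ∈ bigraded (a, b)) :
    X (Sum.inl 0) * pderiv (Sum.inl 0) G + X (Sum.inl 1) * pderiv (Sum.inl 1) G = (a : S) * G := by
  have h : G.IsWeightedHomogeneous (Sum.elim (fun _ => 1) (fun _ => 0) : Idx → ℕ) a := by
    intro u hu
    rw [Finsupp.weight_apply, Finsupp.sum_fintype _ _ (by simp)]
    simpa using (degree_eq_of_mem_bigraded hG hu).1
  simpa using h.sum_weight_X_mul_pderiv

theorem euler_inr {a b : ℕ} {G : S} (hG : G ∈ bigraded (a, b)) :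
    X (Sum.inr 0) * pderiv (Sum.inr 0) G + X (Sum.inr 1) * pderiv (Sum.inr 1) G = (b : S) * G := by
  have h : G.IsWeightedHomogeneous (Sum.elim (fun _ => 0) (fun _ => 1) : Idx → ℕ) b := by
    intro u hu
    rw [Finsupp.weight_apply, Finsupp.sum_fintype _ _ (by simp)]
    simpa using (degree_eq_of_mem_bigraded hG hu).2
  simpa using h.sum_weight_X_mul_pderiv

theorem isHomogeneous_of_mem_bigraded {a b : ℕ} {G : S} (hG : G ∈ bigraded (a, b)) :
    G.IsHomogeneous (a + b) := by
  intro u hu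
  obtain ⟨rfl, rfl⟩ := degree_eq_of_mem_bigraded hG hu
  rw [Finsupp.weight_apply, Finsupp.sum_fintype _ _ (by simp)]
  simp

theorem not_dvd_of_degree_lt {a b a' b' : ℕ} {F G : S} (hF : F ∈ bigraded (a, b))
    (hG : G ∈ bigraded (a', b')) (h0 : G ≠ 0) (hlt : a' + b' < a + b) : ¬ F ∣ G := by
  rintro ⟨H, rfl⟩
  have hF0 : F ≠ 0 := left_ne_zero_of_mul h0
  have h1 := (isHomogeneous_of_mem_bigraded hG).totalDegree h0
  rw [totalDegree_mul_of_isDomain hF0 (right_ne_zero_of_mul h0),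
    (isHomogeneous_of_mem_bigraded hF).totalDegree hF0] at h1
  omega

theorem evalAt_X_inl (p : Surf) (k : Fin 2) : evalAt p (X (Sum.inl k)) = p.1.rep k := by
  simp [evalAt, coords]

theorem evalAt_X_inr (p : Surf) (k : Fin 2) : evalAt p (X (Sum.inr k)) = p.2.rep k := by
  simp [evalAt, coords]

theorem exists_rep_ne_zero (q : P1) : ∃ k, q.rep k ≠ 0 := Function.ne_iff.mp q.rep_nonzero

/-- The linear form `q₀ x₁ - q₁ x₀` in the coordinates of the first factor, whose only zero is the
point `q = [q₀ : q₁]`; the counterpart of `lineThrough`. -/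
noncomputable def lineThroughFst (q : P1) : S :=
  C (q.rep 0) * X (Sum.inl 1) - C (q.rep 1) * X (Sum.inl 0)

theorem lineThroughFst_mem (q : P1) : lineThroughFst q ∈ bigraded (1, 0) :=
  IsWeightedHomogeneous.sub (IsWeightedHomogeneous.C_mul (X_inl_mem 1) _)
    (IsWeightedHomogeneous.C_mul (X_inl_mem 0) _)

theorem lineThrough_mem (q : P1) : lineThrough q ∈ bigraded (0, 1) :=
  IsWeightedHomogeneous.sub (IsWeightedHomogeneous.C_mul (X_inr_mem 1) _)
    (IsWeightedHomogeneous.C_mul (X_inr_mem 0) _)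

theorem evalAt_lineThroughFst (p : Surf) : evalAt p (lineThroughFst p.1) = 0 := by
  simp [lineThroughFst, evalAt, coords]; ring

theorem evalAt_lineThrough (p : Surf) : evalAt p (lineThrough p.2) = 0 := by
  simp [lineThrough, evalAt, coords]; ring

theorem exists_eq_mul_of_proportional {R : Type*} [CommRing R] [Algebra ℂ R] {v : Fin 2 → ℂ}
    (hv : ∃ i, v i ≠ 0) {x : Fin 2 → R}
    (h : algebraMap ℂ R (v 0) * x 1 = algebraMap ℂ R (v 1) * x 0) :
    ∃ r : R, ∀ k, x k = r * algebraMap ℂ R (v k) := by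
  obtain ⟨i, hi⟩ := hv
  refine ⟨algebraMap ℂ R (v i)⁻¹ * x i, fun k => ?_⟩
  have hinv : algebraMap ℂ R (v i)⁻¹ * algebraMap ℂ R (v i) = 1 := by
    rw [← map_mul, inv_mul_cancel₀ hi, map_one]
  have hcross : algebraMap ℂ R (v i) * x k = algebraMap ℂ R (v k) * x i := by
    fin_cases i <;> fin_cases k
    exacts [rfl, h, h.symm, rfl]
  linear_combination (-x k) * hinv + algebraMap ℂ R (v i)⁻¹ * hcross

theorem mem_span_lines {a b : ℕ} {G : S} (hG : G ∈ bigraded (a, b)) {p : Surf}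
    (hp : evalAt p G = 0) : G ∈ Ideal.span {lineThroughFst p.1, lineThrough p.2} := by
  set I : Ideal S := Ideal.span {lineThroughFst p.1, lineThrough p.2}
  let π := Ideal.Quotient.mkₐ ℂ I
  have h1 : π (lineThroughFst p.1) = 0 :=
    Ideal.Quotient.eq_zero_iff_mem.mpr (Ideal.subset_span (by simp))
  have h2 : π (lineThrough p.2) = 0 :=
    Ideal.Quotient.eq_zero_iff_mem.mpr (Ideal.subset_span (by simp))
  have hC (c : ℂ) : (C c : S) = algebraMap ℂ S c := rfl
  rw [lineThroughFst, map_sub, map_mul, map_mul, hC, hC, AlgHom.commutes, AlgHom.commutes,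
    sub_eq_zero] at h1
  rw [lineThrough, map_sub, map_mul, map_mul, hC, hC, AlgHom.commutes, AlgHom.commutes,
    sub_eq_zero] at h2
  -- modulo the two linear forms, the coordinates are proportional to those of `p`
  obtain ⟨r, hr⟩ := exists_eq_mul_of_proportional (exists_rep_ne_zero p.1)
    (x := fun k => π (X (Sum.inl k))) h1
  obtain ⟨s, hs⟩ := exists_eq_mul_of_proportional (exists_rep_ne_zero p.2)
    (x := fun k => π (X (Sum.inr k))) h2
  have hπ : π = aeval (scale r s fun t => algebraMap ℂ (S ⧸ I) (coords p t)) := by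
    ext t
    rw [aeval_X]
    rcases t with k | k
    exacts [hr k, hs k]
  have hz : π G = 0 := by
    have h3 := aeval_algebraMap_apply (S ⧸ I) (coords p) G
    rw [show aeval (coords p) G = 0 from hp, map_zero] at h3
    rw [hπ, aeval_scale hG, show aeval (fun t => algebraMap ℂ (S ⧸ I) (coords p t)) G = 0 from h3,
      mul_zero]
  exact Ideal.Quotient.eq_zero_iff_mem.mp hz

/-- First order Taylor expansion at `p` of a form vanishing at `p`, with bihomogeneous
coefficients. -/
theorem exists_eq_mul_line_add {a b : ℕ} {G : S} (hG : G ∈ bigraded (a + 1, b + 1)) {p : Surf}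
    (hp : evalAt p G = 0) : ∃ P ∈ bigraded (a, b + 1), ∃ Q ∈ bigraded (a + 1, b),
      G = P * lineThroughFst p.1 + Q * lineThrough p.2 := by
  obtain ⟨P, Q, h⟩ := Ideal.mem_span_pair.mp (mem_span_lines hG hp)
  refine ⟨DirectSum.decompose bigraded P (a, b + 1), SetLike.coe_mem _,
    DirectSum.decompose bigraded Q (a + 1, b), SetLike.coe_mem _, ?_⟩
  rw [← DirectSum.coe_decompose_mul_add_of_right_mem bigraded (lineThroughFst_mem p.1),
    ← DirectSum.coe_decompose_mul_add_of_right_mem bigraded (lineThrough_mem p.2)]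
  have h3 : ((a, b + 1) + (1, 0) : ℕ × ℕ) = (a + 1, b + 1) := rfl
  have h4 : ((a + 1, b) + (0, 1) : ℕ × ℕ) = (a + 1, b + 1) := rfl
  rw [h3, h4, ← Submodule.coe_add, ← DirectSum.add_apply, ← DirectSum.decompose_add, h,
    DirectSum.decompose_of_mem_same _ hG]

/-! ### The prime of the cone over a point, and common zeros -/

/-- The restriction of polynomials to the plane of all coordinate vectors `(r x, s y)` of the point
`p = (x, y)`; the polynomial ring in two variables has `r` and `s` as its variables. -/
noncomputable def restrictToCone (p : Surf) : S →ₐ[ℂ] MvPolynomial (Fin 2) ℂ :=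
  aeval (scale (X 0) (X 1) fun t => C (coords p t))

/-- The bihomogeneous prime ideal of the point `p`.  It is smaller than `primeAt p`, the maximal
ideal of one chosen coordinate vector of `p`. -/
noncomputable abbrev conePrime (p : Surf) : Ideal S := RingHom.ker (restrictToCone p)

theorem restrictToCone_apply {a b : ℕ} {G : S} (hG : G ∈ bigraded (a, b)) (p : Surf) :
    restrictToCone p G = X 0 ^ a * X 1 ^ b * C (evalAt p G) := by
  rw [restrictToCone, aeval_scale hG]
  congr 1
  exact aeval_algebraMap_apply _ _ _

theorem mem_conePrime {a b : ℕ} {G : S} (hG : G ∈ bigraded (a, b)) (p : Surf) :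
    G ∈ conePrime p ↔ evalAt p G = 0 := by
  rw [RingHom.mem_ker, restrictToCone_apply hG]
  simp

theorem restrictToCone_surjective (p : Surf) : Function.Surjective (restrictToCone p) := by
  obtain ⟨i, hi⟩ := exists_rep_ne_zero p.1
  obtain ⟨j, hj⟩ := exists_rep_ne_zero p.2
  rw [← AlgHom.range_eq_top, eq_top_iff, ← MvPolynomial.adjoin_range_X, Algebra.adjoin_le_iff]
  rintro _ ⟨k, rfl⟩
  fin_cases k
  · refine ⟨C (p.1.rep i)⁻¹ * X (Sum.inl i), ?_⟩
    have h : (C (p.1.rep i)⁻¹ * C (p.1.rep i) : MvPolynomial (Fin 2) ℂ) = 1 := by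
      rw [← C_mul, inv_mul_cancel₀ hi, C_1]
    simp [restrictToCone, scale, coords]
    linear_combination X 0 * h
  · refine ⟨C (p.2.rep j)⁻¹ * X (Sum.inr j), ?_⟩
    have h : (C (p.2.rep j)⁻¹ * C (p.2.rep j) : MvPolynomial (Fin 2) ℂ) = 1 := by
      rw [← C_mul, inv_mul_cancel₀ hj, C_1]
    simp [restrictToCone, scale, coords]
    linear_combination X 1 * h

theorem ringKrullDim_quotient_conePrime (p : Surf) : ringKrullDim (S ⧸ conePrime p) = 2 := by
  refine (ringKrullDim_eq_of_ringEquiv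
    (RingHom.quotientKerEquivOfSurjective (restrictToCone_surjective p))).trans ?_
  simp

/-- A prime below the cone of `p` that contains `F` and a polynomial not divisible by `F` is the
whole prime of the cone.  Otherwise `0 ⊊ (F) ⊊ Q ⊊ conePrime p` would force the dimension of the
polynomial ring in four variables to be at least `2 + 3`. -/
theorem eq_conePrime {F G : S} (hF : Irreducible F) (hFG : ¬ F ∣ G) {p : Surf} {Q : Ideal S}
    [Q.IsPrime] (hFQ : F ∈ Q) (hGQ : G ∈ Q) (hQ : Q ≤ conePrime p) : Q = conePrime p := by
  by_contra hne
  obtain ⟨r, hr, hrQ⟩ := SetLike.exists_of_lt (lt_of_le_of_ne hQ hne)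
  have hprime : (Ideal.span {F}).IsPrime :=
    (Ideal.span_singleton_prime hF.ne_zero).mpr hF.prime
  have h1 := ringKrullDim_quotient_succ_le (Q := (⊥ : Ideal S)) (P := Ideal.span {F}) (r := F)
    hF.ne_zero (Ideal.mem_span_singleton_self F) bot_le
  have h2 := ringKrullDim_quotient_succ_le (Q := Ideal.span {F}) (P := Q) (r := G)
    (by rwa [Ideal.mem_span_singleton]) hGQ ((Ideal.span_singleton_le_iff_mem _).mpr hFQ)
  have h3 := ringKrullDim_quotient_succ_le hrQ hr hQ
  have h0 : ringKrullDim (S ⧸ (⊥ : Ideal S)) = 4 := by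
    rw [ringKrullDim_eq_of_ringEquiv (RingEquiv.quotientBot S)]
    simp
  rw [ringKrullDim_quotient_conePrime] at h3
  have h5 : (2 + 1 + 1 + 1 : WithBot ℕ∞) ≤ 4 := by
    rw [← h0]
    exact le_trans (by gcongr; exact le_trans (by gcongr) h2) h1
  exact absurd h5 (by decide)

/-- The primes `conePrime p` of the common zeros are minimal over `(F, G)`, and `p` is determined
by `conePrime p`. -/
theorem finite_common_zeros {a b a' b' : ℕ} {F G : S} (hF : Irreducible F) (hFG : ¬ F ∣ G)
    (hFd : F ∈ bigraded (a, b)) (hGd : G ∈ bigraded (a', b')) :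
    {p : Surf | evalAt p F = 0 ∧ evalAt p G = 0}.Finite := by
  have hfin := Ideal.finite_minimalPrimes_of_isNoetherianRing S (Ideal.span {F, G})
  refine Set.Finite.of_finite_image (f := conePrime) (hfin.subset ?_) ?_
  · rintro _ ⟨p, ⟨hpF, hpG⟩, rfl⟩
    refine ⟨⟨RingHom.ker_isPrime _, ?_⟩, ?_⟩
    · rw [Ideal.span_le]
      rintro x (rfl | rfl)
      exacts [(mem_conePrime hFd p).mpr hpF, (mem_conePrime hGd p).mpr hpG]
    · rintro Q ⟨hQ, hle⟩ hQp
      exact (eq_conePrime hF hFG (hle (Ideal.subset_span (by simp)))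
        (hle (Ideal.subset_span (by simp))) hQp).ge
  · intro p _ q _ hpq
    have hx : evalAt q (lineThroughFst p.1) = 0 := by
      rw [← mem_conePrime (lineThroughFst_mem p.1) q]
      exact hpq ▸ (mem_conePrime (lineThroughFst_mem p.1) p).mpr (evalAt_lineThroughFst p)
    have hy : evalAt q (lineThrough p.2) = 0 := by
      rw [← mem_conePrime (lineThrough_mem p.2) q]
      exact hpq ▸ (mem_conePrime (lineThrough_mem p.2) p).mpr (evalAt_lineThrough p)
    have key (u v : P1) (h : u.rep 0 * v.rep 1 - u.rep 1 * v.rep 0 = 0) : u = v := by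
      obtain ⟨r, hr⟩ := exists_eq_mul_of_proportional (R := ℂ) (exists_rep_ne_zero u) (x := v.rep)
        (sub_eq_zero.mp h)
      rw [← u.mk_rep, ← v.mk_rep, eq_comm, Projectivization.mk_eq_mk_iff']
      exact ⟨r, funext fun k => (hr k).symm⟩
    refine Prod.ext (key _ _ ?_) (key _ _ ?_)
    · simpa [lineThroughFst, evalAt, coords] using hx
    · simpa [lineThrough, evalAt, coords] using hy

/-! ### Formal integral curves -/

/-- The series `∑ (Dⁿ G)(p) Tⁿ / n!`, the Taylor series of `G` along the flow of `D` that starts at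
the chosen coordinates of `p`. -/
noncomputable def taylorSeries (D : Derivation ℂ S S) (p : Surf) : S →ₗ[ℂ] PowerSeries ℂ where
  toFun G := PowerSeries.mk fun n =>
    evalAt p (((D : S →ₗ[ℂ] S) ^ n : Module.End ℂ S) G) / (n.factorial : ℂ)
  map_add' G H := by
    ext n
    rw [map_add, PowerSeries.coeff_mk, PowerSeries.coeff_mk, PowerSeries.coeff_mk, map_add,
      map_add, add_div]
  map_smul' c G := by
    ext n
    rw [RingHom.id_apply, map_smul, PowerSeries.coeff_mk, PowerSeries.coeff_mk, map_smul,
      map_smul, smul_eq_mul, smul_eq_mul, mul_div_assoc]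

theorem coeff_taylorSeries (D : Derivation ℂ S S) (p : Surf) (G : S) (n : ℕ) :
    PowerSeries.coeff n (taylorSeries D p G) =
      evalAt p (((D : S →ₗ[ℂ] S) ^ n : Module.End ℂ S) G) / (n.factorial : ℂ) := by
  have h : taylorSeries D p G = PowerSeries.mk fun n =>
      evalAt p (((D : S →ₗ[ℂ] S) ^ n : Module.End ℂ S) G) / (n.factorial : ℂ) := rfl
  rw [h, PowerSeries.coeff_mk]

theorem derivative_taylorSeries (D : Derivation ℂ S S) (p : Surf) (G : S) :
    PowerSeries.derivative ℂ (taylorSeries D p G) = taylorSeries D p (D G) := by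
  ext n
  rw [PowerSeries.coeff_derivative, coeff_taylorSeries, coeff_taylorSeries, pow_succ,
    Module.End.mul_apply, Nat.factorial_succ]
  have h1 : (n.factorial : ℂ) ≠ 0 := by exact_mod_cast n.factorial_ne_zero
  have h2 : (n : ℂ) + 1 ≠ 0 := by exact_mod_cast n.succ_ne_zero
  push_cast
  field_simp

theorem constantCoeff_taylorSeries (D : Derivation ℂ S S) (p : Surf) (G : S) :
    PowerSeries.constantCoeff (taylorSeries D p G) = evalAt p G := by
  rw [← PowerSeries.coeff_zero_eq_constantCoeff_apply]
  simp [coeff_taylorSeries]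

theorem taylorSeries_mul (D : Derivation ℂ S S) (p : Surf) (G H : S) :
    taylorSeries D p (G * H) = taylorSeries D p G * taylorSeries D p H := by
  ext n
  induction n generalizing G H with
  | zero => simp [constantCoeff_taylorSeries]
  | succ n ih =>
    have h2 : (n : ℂ) + 1 ≠ 0 := by exact_mod_cast n.succ_ne_zero
    -- both sides satisfy the same differential equation, by the Leibniz rule
    refine mul_right_cancel₀ h2 ?_
    rw [← PowerSeries.coeff_derivative, ← PowerSeries.coeff_derivative, derivative_taylorSeries,
      Derivation.leibniz, Derivation.leibniz, derivative_taylorSeries, derivative_taylorSeries]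
    simp only [smul_eq_mul, map_add, ih]

theorem taylorSeries_of_map_eq_zero {D : Derivation ℂ S S} {G : S} (h : D G = 0) (p : Surf) :
    taylorSeries D p G = PowerSeries.C (evalAt p G) := by
  refine PowerSeries.derivative.ext ?_ (by simp [constantCoeff_taylorSeries])
  rw [derivative_taylorSeries, h, map_zero, PowerSeries.derivative_C]

/-- The formal integral curve of the vector field `D` through the chosen coordinates of `p`, as the
homomorphism `G ↦ ∑ (Dⁿ G)(p) Tⁿ / n!`. -/
noncomputable def integralCurve (D : Derivation ℂ S S) (p : Surf) : S →ₐ[ℂ] PowerSeries ℂ :=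
  AlgHom.ofLinearMap (taylorSeries D p)
    (by rw [taylorSeries_of_map_eq_zero D.map_one_eq_zero]; simp) (taylorSeries_mul D p)

theorem derivative_integralCurve (D : Derivation ℂ S S) (p : Surf) (G : S) :
    PowerSeries.derivative ℂ (integralCurve D p G) = integralCurve D p (D G) :=
  derivative_taylorSeries D p G

theorem constantCoeff_integralCurve (D : Derivation ℂ S S) (p : Surf) (G : S) :
    PowerSeries.constantCoeff (integralCurve D p G) = evalAt p G :=
  constantCoeff_taylorSeries D p G

theorem integralCurve_of_map_eq_zero {D : Derivation ℂ S S} {G : S} (h : D G = 0) (p : Surf) :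
    integralCurve D p G = PowerSeries.C (evalAt p G) :=
  taylorSeries_of_map_eq_zero h p

theorem order_eq_order_derivative_add_one {f : PowerSeries ℂ}
    (hf : PowerSeries.constantCoeff f = 0) :
    f.order = (PowerSeries.derivative ℂ f).order + 1 := by
  by_cases h0 : PowerSeries.derivative ℂ f = 0
  · have hf0 : f = 0 := PowerSeries.derivative.ext (by rw [h0, map_zero]) (by rw [hf, map_zero])
    rw [h0, hf0, PowerSeries.order_zero, top_add]
  · obtain ⟨n, hn⟩ := ENat.ne_top_iff_exists.mp (mt PowerSeries.order_eq_top.mp h0)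
    obtain ⟨h1, h2⟩ := PowerSeries.order_eq_nat.mp hn.symm
    rw [← hn, ← Nat.cast_succ, PowerSeries.order_eq_nat]
    refine ⟨fun h => h1 (by rw [PowerSeries.coeff_derivative, h, zero_mul]), fun i hi => ?_⟩
    rcases i with _ | i
    · rwa [PowerSeries.coeff_zero_eq_constantCoeff_apply]
    · have h3 := h2 i (by omega)
      rw [PowerSeries.coeff_derivative] at h3
      exact (mul_eq_zero.mp h3).resolve_right (by exact_mod_cast i.succ_ne_zero)

/-- The vector field `F_t ∂_s - F_s ∂_t`, which is tangent to all level sets of `F`. -/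
noncomputable def tangentField (F : S) (s t : Idx) : Derivation ℂ S S :=
  pderiv t F • pderiv s - pderiv s F • pderiv t

theorem tangentField_apply (F G : S) (s t : Idx) :
    tangentField F s t G = pderiv t F * pderiv s G - pderiv s F * pderiv t G := rfl

theorem tangentField_self (F : S) (s t : Idx) : tangentField F s t F = 0 := by
  rw [tangentField_apply]; ring

/-! ### Local rings and orders of vanishing -/

/-- The standard denominator `x_i ^ a * y_j ^ b` of bidegree `(a, b)` at `p`, where `x_i` and `y_j`
are chosen coordinates that do not vanish at `p`. -/
noncomputable def stdDen (p : Surf) (a b : ℕ) : S :=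
  X (Sum.inl (exists_rep_ne_zero p.1).choose) ^ a * X (Sum.inr (exists_rep_ne_zero p.2).choose) ^ b

theorem stdDen_mem (p : Surf) (a b : ℕ) : stdDen p a b ∈ bigraded (a, b) := by
  have h := IsWeightedHomogeneous.mul
    ((X_inl_mem (exists_rep_ne_zero p.1).choose).pow a)
    ((X_inr_mem (exists_rep_ne_zero p.2).choose).pow b)
  simpa [stdDen] using h

theorem evalAt_stdDen (p : Surf) (a b : ℕ) : evalAt p (stdDen p a b) ≠ 0 := by
  rw [stdDen, map_mul, map_pow, map_pow, evalAt_X_inl, evalAt_X_inr]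
  exact mul_ne_zero (pow_ne_zero _ (exists_rep_ne_zero p.1).choose_spec)
    (pow_ne_zero _ (exists_rep_ne_zero p.2).choose_spec)

theorem stdDen_add (p : Surf) (a b a' b' : ℕ) :
    stdDen p (a + a') (b + b') = stdDen p a b * stdDen p a' b' := by
  simp only [stdDen, pow_add]; ring

theorem mem_primeCompl {p : Surf} {G : S} : G ∈ (primeAt p).primeCompl ↔ evalAt p G ≠ 0 := Iff.rfl

/-- The germ at `p` of a form of bidegree `(a, b)`, in the trivialization of `𝒪(a, b)` given by
`stdDen p a b`. -/
noncomputable def germ (p : Surf) {a b : ℕ} {G : S} (hG : G ∈ bigraded (a, b)) : Stalk p :=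
  HomogeneousLocalization.mk ⟨(a, b), ⟨G, hG⟩, ⟨stdDen p a b, stdDen_mem p a b⟩,
    evalAt_stdDen p a b⟩

theorem val_germ (p : Surf) {a b : ℕ} {G : S} (hG : G ∈ bigraded (a, b)) :
    (germ p hG).val = Localization.mk G ⟨stdDen p a b, evalAt_stdDen p a b⟩ :=
  HomogeneousLocalization.val_mk _

theorem germ_add (p : Surf) {a b : ℕ} {G H : S} (hG : G ∈ bigraded (a, b))
    (hH : H ∈ bigraded (a, b)) (h : G + H ∈ bigraded (a, b)) :
    germ p h = germ p hG + germ p hH := by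
  apply HomogeneousLocalization.val_injective
  rw [HomogeneousLocalization.val_add, val_germ, val_germ, val_germ, Localization.add_mk_self]

theorem germ_mul (p : Surf) {a b a' b' : ℕ} {G H : S} (hG : G ∈ bigraded (a, b))
    (hH : H ∈ bigraded (a', b')) (h : G * H ∈ bigraded (a + a', b + b')) :
    germ p h = germ p hG * germ p hH := by
  apply HomogeneousLocalization.val_injective
  rw [HomogeneousLocalization.val_mul, val_germ, val_germ, val_germ, Localization.mk_mul]
  congr 1
  exact Subtype.ext (stdDen_add p a b a' b')

theorem germ_stdDen (p : Surf) (a b : ℕ) : germ p (stdDen_mem p a b) = 1 := by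
  apply HomogeneousLocalization.val_injective
  rw [val_germ, HomogeneousLocalization.val_one]
  exact Localization.mk_self ⟨stdDen p a b, evalAt_stdDen p a b⟩

theorem isUnit_mk_iff {p : Surf}
    (c : HomogeneousLocalization.NumDenSameDeg bigraded (primeAt p).primeCompl) :
    IsUnit (HomogeneousLocalization.mk c : Stalk p) ↔ evalAt p (c.num : S) ≠ 0 := by
  rw [← HomogeneousLocalization.isUnit_iff_isUnit_val, HomogeneousLocalization.val_mk,
    Localization.mk_eq_mk', IsLocalization.AtPrime.isUnit_mk'_iff _ (primeAt p)]
  rfl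

theorem isUnit_germ_iff {p : Surf} {a b : ℕ} {G : S} (hG : G ∈ bigraded (a, b)) :
    IsUnit (germ p hG) ↔ evalAt p G ≠ 0 :=
  isUnit_mk_iff _

theorem mk_mul_germ_den {p : Surf}
    (c : HomogeneousLocalization.NumDenSameDeg bigraded (primeAt p).primeCompl) :
    (HomogeneousLocalization.mk c : Stalk p) * germ p (a := c.deg.1) (b := c.deg.2) c.den.2 =
      germ p (a := c.deg.1) (b := c.deg.2) c.num.2 := by
  apply HomogeneousLocalization.val_injective
  rw [HomogeneousLocalization.val_mul, val_germ, val_germ, HomogeneousLocalization.val_mk,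
    Localization.mk_mul, Localization.mk_eq_mk_iff, Localization.r_iff_exists]
  exact ⟨1, by simp; ring⟩

theorem associated_mk_germ {p : Surf}
    (c : HomogeneousLocalization.NumDenSameDeg bigraded (primeAt p).primeCompl) :
    Associated (HomogeneousLocalization.mk c : Stalk p)
      (germ p (a := c.deg.1) (b := c.deg.2) c.num.2) :=
  have h : IsUnit (germ p (a := c.deg.1) (b := c.deg.2) c.den.2) :=
    (isUnit_germ_iff _).mpr (mem_primeCompl.mp c.den_mem)
  ⟨h.unit, mk_mul_germ_den c⟩

theorem germIdeal_eq_span (p : Surf) {a b : ℕ} {G : S} (hG : G ∈ bigraded (a, b)) :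
    germIdeal p G = Ideal.span {germ p hG} := by
  refine le_antisymm (Ideal.span_le.mpr ?_) (Ideal.span_mono ?_)
  · rintro _ ⟨c, hc, rfl⟩
    by_cases h0 : G = 0
    · rw [HomogeneousLocalization.mk_eq_zero_of_num c (Subtype.ext (hc.trans h0))]
      exact zero_mem _
    · obtain ⟨⟨a', b'⟩, ⟨G', hG'⟩, D, hD⟩ := c
      obtain rfl : G' = G := hc
      obtain ⟨rfl, rfl⟩ := Prod.mk.inj (IsWeightedHomogeneous.inj_right h0 hG hG')
      exact Ideal.mem_span_singleton.mpr (associated_mk_germ _).dvd'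
  · rintro _ rfl
    exact ⟨_, rfl, rfl⟩

theorem maximalIdeal_stalk (p : Surf) : IsLocalRing.maximalIdeal (Stalk p) =
    Ideal.span {germ p (lineThroughFst_mem p.1), germ p (lineThrough_mem p.2)} := by
  refine le_antisymm ?_ (Ideal.span_le.mpr ?_)
  · intro x hx
    obtain ⟨c, rfl⟩ := HomogeneousLocalization.mk_surjective x
    have hc : evalAt p (c.num : S) = 0 := by
      by_contra h
      exact hx ((isUnit_mk_iff c).mpr h)
    obtain ⟨u, hu⟩ := (associated_mk_germ c).symm
    -- multiplication by `x_i y_j` makes both degrees positive and does not change the germ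
    have hmul : (c.num : S) * stdDen p 1 1 ∈ bigraded (c.deg.1 + 1, c.deg.2 + 1) :=
      IsWeightedHomogeneous.mul c.num.2 (stdDen_mem p 1 1)
    obtain ⟨P, hP, Q, hQ, h⟩ := exists_eq_mul_line_add hmul (p := p) (by rw [map_mul, hc, zero_mul])
    have h1 : P * lineThroughFst p.1 ∈ bigraded (c.deg.1 + 1, c.deg.2 + 1) :=
      IsWeightedHomogeneous.mul hP (lineThroughFst_mem p.1)
    have h2 : Q * lineThrough p.2 ∈ bigraded (c.deg.1 + 1, c.deg.2 + 1) :=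
      IsWeightedHomogeneous.mul hQ (lineThrough_mem p.2)
    have h3 := germ_mul p (a := c.deg.1) (b := c.deg.2) c.num.2 (stdDen_mem p 1 1) hmul
    rw [germ_stdDen, mul_one] at h3
    have h4 : germ p hmul = germ p hP * germ p (lineThroughFst_mem p.1) +
        germ p hQ * germ p (lineThrough_mem p.2) := by
      rw [← germ_mul p hP (lineThroughFst_mem p.1) h1, ← germ_mul p hQ (lineThrough_mem p.2) h2,
        ← germ_add p h1 h2 (h ▸ hmul)]
      congr 1
    rw [← hu, ← h3, h4]
    exact Ideal.mul_mem_right _ _ (Ideal.mem_span_pair.mpr ⟨_, _, rfl⟩)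
  · rintro x (rfl | rfl)
    · exact fun h => (isUnit_germ_iff _).mp h (evalAt_lineThroughFst p)
    · exact fun h => (isUnit_germ_iff _).mp h (evalAt_lineThrough p)

section Pullback

variable {p : Surf} {Φ : S →ₐ[ℂ] PowerSeries ℂ}

theorem isUnit_of_evalAt_ne_zero (hΦ : ∀ G, PowerSeries.constantCoeff (Φ G) = evalAt p G) {G : S}
    (hG : evalAt p G ≠ 0) : IsUnit (Φ G) := by
  rw [PowerSeries.isUnit_iff_constantCoeff, hΦ]
  exact hG.isUnit

/-- The homomorphism to `ℂ⟦T⟧` of the localization of `S` at the chosen coordinates of `p` that is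
induced by a formal arc `Φ` with these coordinates as its origin. -/
noncomputable def localizationMap (hΦ : ∀ G, PowerSeries.constantCoeff (Φ G) = evalAt p G) :
    Localization (primeAt p).primeCompl →+* PowerSeries ℂ :=
  IsLocalization.lift (M := (primeAt p).primeCompl) (g := (Φ : S →+* PowerSeries ℂ))
    fun G => isUnit_of_evalAt_ne_zero hΦ G.2

theorem localizationMap_algebraMap (hΦ : ∀ G, PowerSeries.constantCoeff (Φ G) = evalAt p G)
    (G : S) : localizationMap hΦ (algebraMap S _ G) = Φ G :=
  IsLocalization.lift_eq _ G

/-- The pull-back of germs of functions along a formal arc `Φ` through `p`. -/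
noncomputable def stalkMap (hΦ : ∀ G, PowerSeries.constantCoeff (Φ G) = evalAt p G) :
    Stalk p →+* PowerSeries ℂ :=
  (localizationMap hΦ).comp (algebraMap (Stalk p) (Localization (primeAt p).primeCompl))

theorem stalkMap_germ_mul (hΦ : ∀ G, PowerSeries.constantCoeff (Φ G) = evalAt p G) {a b : ℕ}
    {G : S} (hG : G ∈ bigraded (a, b)) :
    stalkMap hΦ (germ p hG) * Φ (stdDen p a b) = Φ G := by
  have h : stalkMap hΦ (germ p hG) = localizationMap hΦ (germ p hG).val := rfl
  have h2 : (germ p hG).val * algebraMap S _ (stdDen p a b) = algebraMap S _ G := by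
    rw [val_germ, Localization.mk_eq_mk']
    exact IsLocalization.mk'_spec _ G ⟨stdDen p a b, evalAt_stdDen p a b⟩
  rw [h, ← localizationMap_algebraMap hΦ, ← map_mul, h2, localizationMap_algebraMap]

theorem order_stalkMap_germ (hΦ : ∀ G, PowerSeries.constantCoeff (Φ G) = evalAt p G) {a b : ℕ}
    {G : S} (hG : G ∈ bigraded (a, b)) : (stalkMap hΦ (germ p hG)).order = (Φ G).order := by
  rw [← stalkMap_germ_mul hΦ hG, PowerSeries.order_mul, PowerSeries.order_zero_of_unit
    (isUnit_of_evalAt_ne_zero hΦ (evalAt_stdDen p a b)), add_zero]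

/-- If a form `ℓ` of order one along the arc `Φ` in `{F = 0}` generates the maximal ideal of
`𝒪_{Z,p}`, then the order of vanishing at `p` is the order along `Φ`. -/
theorem ordAt_eq_order (hΦ : ∀ G, PowerSeries.constantCoeff (Φ G) = evalAt p G)
    {d e : ℕ} {F : S} (hF : F ∈ bigraded (d, e)) (hΦF : Φ F = 0)
    {m n : ℕ} {ℓ : S} (hℓ : ℓ ∈ bigraded (m, n)) (hord : (Φ ℓ).order = 1)
    (hmax : IsLocalRing.maximalIdeal (Stalk p) ≤ Ideal.span {germ p hF, germ p hℓ})
    {a b : ℕ} {G : S} (hG : G ∈ bigraded (a, b)) : ordAt F p G = (Φ G).order := by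
  have hker : germIdeal p F ≤ RingHom.ker (stalkMap hΦ) := by
    rw [germIdeal_eq_span p hF, Ideal.span_singleton_le_iff_mem, RingHom.mem_ker,
      ← PowerSeries.order_eq_top, order_stalkMap_germ, hΦF, PowerSeries.order_zero]
  let f : CurveStalk F p →+* PowerSeries ℂ := Ideal.Quotient.lift _ (stalkMap hΦ) hker
  have hf {a b : ℕ} {G : S} (hG : G ∈ bigraded (a, b)) :
      (f (Ideal.Quotient.mk _ (germ p hG))).order = (Φ G).order := by
    rw [← order_stalkMap_germ hΦ hG]; rfl
  have : Nontrivial (CurveStalk F p) := f.domain_nontrivial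
  have hloc : IsLocalRing (CurveStalk F p) :=
    IsLocalRing.of_surjective' (Ideal.Quotient.mk _) Ideal.Quotient.mk_surjective
  have ht : IsLocalRing.maximalIdeal (CurveStalk F p) =
      Ideal.span {Ideal.Quotient.mk _ (germ p hℓ)} := by
    refine le_antisymm ?_ ?_
    · intro x hx
      obtain ⟨y, rfl⟩ := Ideal.Quotient.mk_surjective x
      have hy : y ∈ IsLocalRing.maximalIdeal (Stalk p) := fun hu => hx (hu.map _)
      obtain ⟨r, s, rfl⟩ := Ideal.mem_span_pair.mp (hmax hy)
      have h0 : Ideal.Quotient.mk (germIdeal p F) (germ p hF) = 0 := by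
        rw [Ideal.Quotient.eq_zero_iff_mem, germIdeal_eq_span p hF]
        exact Ideal.mem_span_singleton_self _
      rw [map_add, map_mul, map_mul, h0, mul_zero, zero_add]
      exact Ideal.mul_mem_left _ _ (Ideal.mem_span_singleton_self _)
    · rw [Ideal.span_singleton_le_iff_mem]
      intro hu
      have h1 := hf hℓ
      rw [PowerSeries.order_zero_of_unit (hu.map f), hord] at h1
      exact zero_ne_one h1
  rw [ordAt, germIdeal_eq_span p hG, Ideal.map_span, Set.image_singleton,
    length_quotient_span_singleton ht ((hf hℓ).trans hord), hf hG]

end Pullback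

/-! ### Parametrization of a smooth curve at a point -/

theorem one_sub_ne (i : Fin 2) : 1 - i ≠ i := by fin_cases i <;> decide

theorem pderiv_lineThroughFst {q : P1} {i : Fin 2} (hi : q.rep i ≠ 0) :
    ∃ c : ℂ, c ≠ 0 ∧ pderiv (Sum.inl (1 - i)) (lineThroughFst q) = C c := by
  fin_cases i
  · exact ⟨q.rep 0, hi, by simp [lineThroughFst, pderiv_X]⟩
  · exact ⟨-q.rep 1, neg_ne_zero.mpr hi, by simp [lineThroughFst, pderiv_X]⟩

theorem pderiv_lineThrough {q : P1} {j : Fin 2} (hj : q.rep j ≠ 0) :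
    ∃ c : ℂ, c ≠ 0 ∧ pderiv (Sum.inr (1 - j)) (lineThrough q) = C c := by
  fin_cases j
  · exact ⟨q.rep 0, hj, by simp [lineThrough, pderiv_X]⟩
  · exact ⟨-q.rep 1, neg_ne_zero.mpr hj, by simp [lineThrough, pderiv_X]⟩

theorem euler_fst_at {a b : ℕ} {F : S} (hF : F ∈ bigraded (a, b)) {p : Surf} (hp : evalAt p F = 0)
    {i : Fin 2} (hi : p.1.rep i ≠ 0) (h : evalAt p (pderiv (Sum.inl (1 - i)) F) = 0) (k : Fin 2) :
    evalAt p (pderiv (Sum.inl k) F) = 0 := by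
  have he := congrArg (evalAt p) (euler_inl hF)
  simp only [map_add, map_mul, hp, mul_zero, evalAt_X_inl] at he
  fin_cases i <;> fin_cases k <;> simp_all

theorem euler_snd_at {a b : ℕ} {F : S} (hF : F ∈ bigraded (a, b)) {p : Surf} (hp : evalAt p F = 0)
    {j : Fin 2} (hj : p.2.rep j ≠ 0) (h : evalAt p (pderiv (Sum.inr (1 - j)) F) = 0) (k : Fin 2) :
    evalAt p (pderiv (Sum.inr k) F) = 0 := by
  have he := congrArg (evalAt p) (euler_inr hF)
  simp only [map_add, map_mul, hp, mul_zero, evalAt_X_inr] at he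
  fin_cases j <;> fin_cases k <;> simp_all

/-- Forms not divisible by `F` have finite order along an arc in `{F = 0}` that moves away from
`p`. -/
theorem integralCurve_ne_zero {a b a' b' m n : ℕ} {F G ℓ : S} (hirr : Irreducible F)
    (hFG : ¬ F ∣ G) (hF : F ∈ bigraded (a, b)) (hG : G ∈ bigraded (a', b'))
    (hℓ : ℓ ∈ bigraded (m, n)) {p : Surf}
    {Φ : S →ₐ[ℂ] PowerSeries ℂ} (hΦ : ∀ G, PowerSeries.constantCoeff (Φ G) = evalAt p G)
    (hΦF : Φ F = 0) (hℓp : evalAt p ℓ = 0) (hΦℓ : Φ ℓ ≠ 0) : Φ G ≠ 0 := by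
  intro hG0
  -- the arc, moved by the scalings of the two coordinate blocks
  let Ψ : S →ₐ[ℂ] MvPolynomial (Fin 2) (PowerSeries ℂ) :=
    aeval (scale (X 0) (X 1) fun t => C (Φ (X t)))
  have hΨ {a b : ℕ} {H : S} (hH : H ∈ bigraded (a, b)) : Ψ H = X 0 ^ a * X 1 ^ b * C (Φ H) := by
    have h1 : Φ = aeval fun t => Φ (X t) := by ext; simp
    have h2 := aeval_algebraMap_apply (MvPolynomial (Fin 2) (PowerSeries ℂ))
      (fun t => Φ (X t)) H
    rw [← h1] at h2
    show aeval _ H = _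
    rw [aeval_scale hH]
    congr 1
  have hΨ0 {a b : ℕ} {H : S} (hH : H ∈ bigraded (a, b)) (h : Φ H = 0) : H ∈ RingHom.ker Ψ := by
    rw [RingHom.mem_ker, hΨ hH, h, C_0, mul_zero]
  have hle : RingHom.ker Ψ ≤ conePrime p := by
    have hcomp : (map (PowerSeries.constantCoeff (R := ℂ))).comp (Ψ : S →+* _) =
        (restrictToCone p : S →+* MvPolynomial (Fin 2) ℂ) := by
      refine MvPolynomial.ringHom_ext (fun c => ?_) fun t => ?_
      · simp [Ψ, restrictToCone, algebraMap_eq, MvPolynomial.algebraMap_apply]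
      · have h3 := hΦ (X t)
        simp only [evalAt, aeval_X] at h3
        rcases t with k | k <;> simp [Ψ, restrictToCone, scale, h3]
    intro H hH
    rw [RingHom.mem_ker] at hH ⊢
    have h4 := congrArg (fun f => f H) hcomp
    simp only [RingHom.comp_apply, RingHom.coe_coe, hH, map_zero] at h4
    exact h4.symm
  have hprime : (RingHom.ker Ψ).IsPrime := RingHom.ker_isPrime _
  have heq := eq_conePrime hirr hFG (hΨ0 hF hΦF) (hΨ0 hG hG0) hle
  have hmem : ℓ ∈ RingHom.ker Ψ := heq ▸ (mem_conePrime hℓ p).mpr hℓp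
  rw [RingHom.mem_ker, hΨ hℓ] at hmem
  exact hΦℓ (by simpa using hmem)

/-- At a point of a smooth curve `{F = 0}` there is a formal arc `Φ` along which orders of forms
are their orders of vanishing, these are finite unless `F` divides the form, and the ramification
index of the second projection exceeds the order of `F_{x_{1-i}}` by one, where `x_i ≠ 0` at `p`. -/
theorem exists_parametrization {d e : ℕ} {F : S} (hF : F ∈ bigraded (d + 1, e + 1))
    (hirr : Irreducible F) (hsm : IsSmooth F) {p : Surf} (hp : p ∈ Z F) :
    ∃ Φ : S →ₐ[ℂ] PowerSeries ℂ, (∀ G, PowerSeries.constantCoeff (Φ G) = evalAt p G) ∧ Φ F = 0 ∧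
      (∀ {a b : ℕ} {G : S}, G ∈ bigraded (a, b) → ordAt F p G = (Φ G).order) ∧
      (∀ {a b : ℕ} {G : S}, G ∈ bigraded (a, b) → ¬ F ∣ G → Φ G ≠ 0) ∧
      ∃ i, p.1.rep i ≠ 0 ∧
        (Φ (lineThrough p.2)).order = (Φ (pderiv (Sum.inl (1 - i)) F)).order + 1 := by
  obtain ⟨i, hi⟩ := exists_rep_ne_zero p.1
  obtain ⟨j, hj⟩ := exists_rep_ne_zero p.2
  let D := tangentField F (Sum.inl (1 - i)) (Sum.inr (1 - j))
  let Φ := integralCurve D p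
  have hΦ (G : S) : PowerSeries.constantCoeff (Φ G) = evalAt p G :=
    constantCoeff_integralCurve D p G
  have hpF : evalAt p F = 0 := hp
  have hΦF : Φ F = 0 := by
    rw [integralCurve_of_map_eq_zero (tangentField_self _ _ _), hpF, map_zero]
  obtain ⟨c, hc, hcx⟩ := pderiv_lineThroughFst hi
  obtain ⟨c', hc', hcy⟩ := pderiv_lineThrough hj
  have hC (c : ℂ) (hc : c ≠ 0) : (Φ (C c)).order = 0 :=
    PowerSeries.order_zero_of_unit
      (isUnit_of_evalAt_ne_zero hΦ (by rwa [evalAt, algHom_C]))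
  -- the derivative along the curve of one linear form is the partial derivative of `F` with
  -- respect to the other variable, up to a nonzero constant
  have hx : (Φ (lineThroughFst p.1)).order = (Φ (pderiv (Sum.inr (1 - j)) F)).order + 1 := by
    have hD : D (lineThroughFst p.1) = pderiv (Sum.inr (1 - j)) F * C c := by
      rw [tangentField_apply, hcx, lineThroughFst]
      simp [pderiv_X]
    rw [order_eq_order_derivative_add_one (by rw [hΦ, evalAt_lineThroughFst]),
      derivative_integralCurve, hD, map_mul, PowerSeries.order_mul, hC c hc, add_zero]
  have hy : (Φ (lineThrough p.2)).order = (Φ (pderiv (Sum.inl (1 - i)) F)).order + 1 := by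
    have hD : D (lineThrough p.2) = - (pderiv (Sum.inl (1 - i)) F * C c') := by
      rw [tangentField_apply, hcy, lineThrough]
      simp [pderiv_X]
    rw [order_eq_order_derivative_add_one (by rw [hΦ, evalAt_lineThrough]),
      derivative_integralCurve, hD, map_neg, PowerSeries.order_neg, map_mul, PowerSeries.order_mul,
      hC c' hc', add_zero]
  obtain ⟨P, hP, Q, hQ, hPQ⟩ := exists_eq_mul_line_add hF hpF
  have hev (c : ℂ) : evalAt p (C c) = c := algHom_C _ _
  -- the coefficients in the expansion of `F` at `p` are its partial derivatives, up to constants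
  have hPp : evalAt p (pderiv (Sum.inl (1 - i)) F) = c * evalAt p P := by
    have h0 : pderiv (Sum.inl (1 - i)) (lineThrough p.2) = 0 := by
      simp [lineThrough, pderiv_X]
    rw [hPQ, map_add, Derivation.leibniz, Derivation.leibniz, hcx, h0]
    simp only [map_add, map_mul, smul_eq_mul, evalAt_lineThroughFst, evalAt_lineThrough, hev,
      map_zero]
    ring
  have hQp : evalAt p (pderiv (Sum.inr (1 - j)) F) = c' * evalAt p Q := by
    have h0 : pderiv (Sum.inr (1 - j)) (lineThroughFst p.1) = 0 := by
      simp [lineThroughFst, pderiv_X]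
    rw [hPQ, map_add, Derivation.leibniz, Derivation.leibniz, hcy, h0]
    simp only [map_add, map_mul, smul_eq_mul, evalAt_lineThroughFst, evalAt_lineThrough, hev,
      map_zero]
    ring
  have hgerm : germ p hF = germ p hP * germ p (lineThroughFst_mem p.1) +
      germ p hQ * germ p (lineThrough_mem p.2) := by
    have h1 : P * lineThroughFst p.1 ∈ bigraded (d + 1, e + 1) :=
      IsWeightedHomogeneous.mul hP (lineThroughFst_mem p.1)
    have h2 : Q * lineThrough p.2 ∈ bigraded (d + 1, e + 1) :=
      IsWeightedHomogeneous.mul hQ (lineThrough_mem p.2)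
    rw [← germ_mul p hP (lineThroughFst_mem p.1) h1, ← germ_mul p hQ (lineThrough_mem p.2) h2,
      ← germ_add p h1 h2 (hPQ ▸ hF)]
    congr 1
  suffices h : ∃ (m n : ℕ) (ℓ : S) (hℓ : ℓ ∈ bigraded (m, n)), evalAt p ℓ = 0 ∧ (Φ ℓ).order = 1 ∧
      IsLocalRing.maximalIdeal (Stalk p) ≤ Ideal.span {germ p hF, germ p hℓ} by
    obtain ⟨m, n, ℓ, hℓ, hℓp, hord, hmax⟩ := h
    have hℓ0 : Φ ℓ ≠ 0 := by
      intro h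
      rw [h, PowerSeries.order_zero] at hord
      exact ENat.top_ne_one hord
    exact ⟨Φ, hΦ, hΦF, fun hG => ordAt_eq_order hΦ hF hΦF hℓ hord hmax hG,
      fun hG hFG => integralCurve_ne_zero hirr hFG hF hG hℓ hΦ hΦF hℓp hℓ0, i, hi, hy⟩
  have hunit {G : S} (h : evalAt p G ≠ 0) : (Φ G).order = 0 :=
    PowerSeries.order_zero_of_unit (isUnit_of_evalAt_ne_zero hΦ h)
  by_cases h : evalAt p (pderiv (Sum.inr (1 - j)) F) = 0
  · have h' : evalAt p (pderiv (Sum.inl (1 - i)) F) ≠ 0 := by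
      intro h'
      obtain ⟨s | s, hs⟩ := hsm p hp
      exacts [hs (euler_fst_at hF hpF hi h' s), hs (euler_snd_at hF hpF hj h s)]
    refine ⟨_, _, _, lineThrough_mem p.2, evalAt_lineThrough p, by rw [hy, hunit h', zero_add], ?_⟩
    have hu : IsUnit (germ p hP) := (isUnit_germ_iff hP).mpr (right_ne_zero_of_mul (hPp ▸ h'))
    rw [maximalIdeal_stalk, Ideal.span_le]
    rintro x (rfl | rfl)
    · refine Ideal.mem_span_pair.mpr ⟨(hu.unit⁻¹ : (Stalk p)ˣ),
        -(hu.unit⁻¹ : (Stalk p)ˣ) * germ p hQ, ?_⟩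
      rw [hgerm]
      linear_combination germ p (lineThroughFst_mem p.1) * hu.val_inv_mul
    · exact Ideal.subset_span (by simp)
  · refine ⟨_, _, _, lineThroughFst_mem p.1, evalAt_lineThroughFst p,
      by rw [hx, hunit h, zero_add], ?_⟩
    have hu : IsUnit (germ p hQ) := (isUnit_germ_iff hQ).mpr (right_ne_zero_of_mul (hQp ▸ h))
    rw [maximalIdeal_stalk, Ideal.span_le]
    rintro x (rfl | rfl)
    · exact Ideal.subset_span (by simp)
    · refine Ideal.mem_span_pair.mpr ⟨(hu.unit⁻¹ : (Stalk p)ˣ),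
        -(hu.unit⁻¹ : (Stalk p)ˣ) * germ p hP, ?_⟩
      rw [hgerm]
      linear_combination germ p (lineThrough_mem p.2) * hu.val_inv_mul

/-! ### Laurent polynomials -/

theorem eq_one_sub_of_ne : ∀ {l i : Fin 2}, l ≠ i → l = 1 - i := by decide

theorem lderiv_single (s : Idx) (u : Idx → ℤ) (c : ℂ) :
    lderiv s (AddMonoidAlgebra.single u c) =
      AddMonoidAlgebra.single (u - Pi.single s 1) (u s * c) := by
  simp [lderiv]

theorem toLaurent_pderiv (s : Idx) (G : S) : toLaurent (pderiv s G) = lderiv s (toLaurent G) := by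
  induction G using MvPolynomial.induction_on' with
  | monomial u c =>
    rw [pderiv_monomial, toLaurent_monomial, toLaurent_monomial, lderiv_single]
    by_cases h : u s = 0
    · simp [h]
    · congr 1
      · funext t
        by_cases hts : t = s
        · subst hts
          simp
          omega
        · simp [hts]
      · push_cast; ring
  | add P Q hP hQ => rw [map_add, map_add, map_add, map_add, hP, hQ]

theorem coeff_toLaurent (G : S) (u : Idx →₀ ℕ) :
    (toLaurent G).coeff (fun s => (u s : ℤ)) = coeff u G := by
  induction G using MvPolynomial.induction_on' with
  | monomial v c =>
    rw [toLaurent_monomial, coeff_monomial, AddMonoidAlgebra.coeff_single, Finsupp.single_apply]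
    congr 1
    simp [funext_iff, DFunLike.ext_iff]
  | add P Q hP hQ => rw [map_add, coeff_add, AddMonoidAlgebra.coeff_add, Finsupp.add_apply, hP, hQ]

theorem toLaurent_injective : Function.Injective toLaurent := by
  intro G H h
  ext u
  rw [← coeff_toLaurent, h, coeff_toLaurent]

theorem coeff_lvar_mul_lderiv (s : Idx) (f : Laurent) (u : Idx → ℤ) :
    (lvar s * lderiv s f).coeff u = u s * f.coeff u := by
  induction f using AddMonoidAlgebra.induction_linear with
  | zero => simp
  | add f g hf hg =>
    rw [map_add, mul_add, AddMonoidAlgebra.coeff_add, Finsupp.add_apply, hf, hg,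
      AddMonoidAlgebra.coeff_add, Finsupp.add_apply, mul_add]
  | single v c =>
    rw [lderiv_single, lvar, AddMonoidAlgebra.single_mul_single, AddMonoidAlgebra.coeff_single,
      AddMonoidAlgebra.coeff_single, Finsupp.single_apply, Finsupp.single_apply,
      add_sub_cancel, one_mul]
    split_ifs with h
    · rw [h]
    · rw [mul_zero]

theorem laurent_euler_inl {d e : ℤ} {σ : Laurent} (hσ : σ ∈ torusSections d e) (i : Fin 2) :
    lvar (Sum.inl i) * lderiv (Sum.inl i) σ +
      lvar (Sum.inl (1 - i)) * lderiv (Sum.inl (1 - i)) σ = (d : ℂ) • σ := by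
  ext u
  rw [AddMonoidAlgebra.coeff_add, Finsupp.add_apply, coeff_lvar_mul_lderiv, coeff_lvar_mul_lderiv,
    AddMonoidAlgebra.coeff_smul, Finsupp.smul_apply, ← add_mul, smul_eq_mul]
  by_cases hu : σ.coeff u = 0
  · simp [hu]
  · have h := AddMonoidAlgebra.mem_supported.mp hσ (Finsupp.mem_support_iff.mpr hu)
    congr 1
    rw [← h.1]
    fin_cases i <;> simp [add_comm]

theorem laurent_euler_inr {d e : ℤ} {σ : Laurent} (hσ : σ ∈ torusSections d e) (j : Fin 2) :
    lvar (Sum.inr j) * lderiv (Sum.inr j) σ +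
      lvar (Sum.inr (1 - j)) * lderiv (Sum.inr (1 - j)) σ = (e : ℂ) • σ := by
  ext u
  rw [AddMonoidAlgebra.coeff_add, Finsupp.add_apply, coeff_lvar_mul_lderiv, coeff_lvar_mul_lderiv,
    AddMonoidAlgebra.coeff_smul, Finsupp.smul_apply, ← add_mul, smul_eq_mul]
  by_cases hu : σ.coeff u = 0
  · simp [hu]
  · have h := AddMonoidAlgebra.mem_supported.mp hσ (Finsupp.mem_support_iff.mpr hu)
    congr 1
    rw [← h.2]
    fin_cases j <;> simp [add_comm]

theorem single_mem_chartSections {i j : Fin 2} {m n : ℤ} {w : Idx → ℤ} (c : ℂ)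
    (hx : w (Sum.inl 0) + w (Sum.inl 1) = m) (hy : w (Sum.inr 0) + w (Sum.inr 1) = n)
    (h1 : 0 ≤ w (Sum.inl (1 - i))) (h2 : 0 ≤ w (Sum.inr (1 - j))) :
    AddMonoidAlgebra.single w c ∈ chartSections i j m n := by
  rw [chartSections, AddMonoidAlgebra.mem_supported]
  refine (Finset.coe_subset.mpr Finsupp.support_single_subset).trans ?_
  simpa using ⟨⟨hx, hy⟩, h1, h2⟩

/-! ### Global differential operators and Jacobian ideals -/

/-- For a monomial `t ^ w` of bidegree `(m + 1, n)`, the operator `t ^ w ∂/∂x_l` is global.  On a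
chart with `x_l ≠ 0` it is rewritten by means of the Euler relation `∑ x_k ∂/∂x_k = d`. -/
theorem mul_lderiv_inl_mem_globalOps {d e m n : ℤ} {w : Idx → ℤ} (hw : ∀ s, 0 ≤ w s)
    (hx : w (Sum.inl 0) + w (Sum.inl 1) = m + 1) (hy : w (Sum.inr 0) + w (Sum.inr 1) = n)
    (l : Fin 2) :
    ((LinearMap.mulLeft ℂ (AddMonoidAlgebra.single w 1)).comp (lderiv (Sum.inl l))).comp
      (torusSections d e).subtype ∈ globalOps d e m n := by
  intro i j
  have hne : (Sum.inl i : Idx) ≠ Sum.inl (1 - i) := fun h => one_sub_ne i (Sum.inl.inj h).symm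
  have hw1 := hw (Sum.inl (1 - i))
  have hsum (v : Idx → ℤ) : v (Sum.inl 0) + v (Sum.inl 1) =
      v (Sum.inl i) + v (Sum.inl (1 - i)) := by
    fin_cases i <;> simp [add_comm]
  rw [hsum] at hx
  by_cases hl : l = i
  · subst hl
    refine ⟨AddMonoidAlgebra.single (w - Pi.single (Sum.inl l) 1) (d : ℂ),
      single_mem_chartSections _ ?_ ?_ ?_ ?_,
      AddMonoidAlgebra.single (w - Pi.single (Sum.inl l) 1 - Pi.single (Sum.inl l) 1
        + Pi.single (Sum.inl (1 - l)) 1) (-1),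
      single_mem_chartSections _ ?_ ?_ ?_ ?_, 0, zero_mem _, ?_⟩
    · rw [hsum]; simp [hne.symm]; omega
    · simpa using hy
    · simpa [hne, hne.symm] using hw1
    · simpa using hw (Sum.inr (1 - j))
    · rw [hsum]; simp [hne, hne.symm]; omega
    · simpa using hy
    · simp [hne.symm]; omega
    · simpa using hw (Sum.inr (1 - j))
    · ext σ : 1
      have hE := laurent_euler_inl σ.2 l
      set a : Laurent := AddMonoidAlgebra.single (w - Pi.single (Sum.inl l) 1) 1 with ha
      have h1 : AddMonoidAlgebra.single w (1 : ℂ) = a * lvar (Sum.inl l) := by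
        simp [ha, lvar, AddMonoidAlgebra.single_mul_single]
      have h2 : AddMonoidAlgebra.single (w - Pi.single (Sum.inl l) 1) (d : ℂ) = (d : ℂ) • a := by
        simp [ha]
      have h3 : AddMonoidAlgebra.single (w - Pi.single (Sum.inl l) 1 - Pi.single (Sum.inl l) 1
          + Pi.single (Sum.inl (1 - l)) 1) (-1 : ℂ) * lvar (Sum.inl l) =
          -(a * lvar (Sum.inl (1 - l))) := by
        rw [ha, lvar, lvar, AddMonoidAlgebra.single_mul_single, AddMonoidAlgebra.single_mul_single,
          ← AddMonoidAlgebra.single_neg]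
        congr 1
        · abel
        · ring
      simp only [chartOp, LinearMap.comp_apply, LinearMap.add_apply, LinearMap.mulLeft_apply,
        Submodule.subtype_apply, h1, h2, h3, zero_mul, add_zero, smul_mul_assoc]
      rw [← mul_smul_comm, ← hE]
      ring
  · obtain rfl := eq_one_sub_of_ne hl
    refine ⟨0, zero_mem _, AddMonoidAlgebra.single (w - Pi.single (Sum.inl i) 1) 1,
      single_mem_chartSections _ ?_ ?_ ?_ ?_, 0, zero_mem _, ?_⟩
    · rw [hsum]; simp [hne.symm]; omega
    · simpa using hy
    · simpa [hne, hne.symm] using hw1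
    · simpa using hw (Sum.inr (1 - j))
    · ext σ : 1
      simp [chartOp, lvar, AddMonoidAlgebra.single_mul_single]
/-- For a monomial `t ^ w` of bidegree `(m, n + 1)`, the operator `t ^ w ∂/∂y_l` is global. -/
theorem mul_lderiv_inr_mem_globalOps {d e m n : ℤ} {w : Idx → ℤ} (hw : ∀ s, 0 ≤ w s)
    (hx : w (Sum.inl 0) + w (Sum.inl 1) = m) (hy : w (Sum.inr 0) + w (Sum.inr 1) = n + 1)
    (l : Fin 2) :
    ((LinearMap.mulLeft ℂ (AddMonoidAlgebra.single w 1)).comp (lderiv (Sum.inr l))).comp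
      (torusSections d e).subtype ∈ globalOps d e m n := by
  intro j i
  have hne : (Sum.inr i : Idx) ≠ Sum.inr (1 - i) := fun h => one_sub_ne i (Sum.inr.inj h).symm
  have hw1 := hw (Sum.inr (1 - i))
  have hsum (v : Idx → ℤ) : v (Sum.inr 0) + v (Sum.inr 1) =
      v (Sum.inr i) + v (Sum.inr (1 - i)) := by
    fin_cases i <;> simp [add_comm]
  rw [hsum] at hy
  by_cases hl : l = i
  · subst hl
    refine ⟨AddMonoidAlgebra.single (w - Pi.single (Sum.inr l) 1) (e : ℂ),
      single_mem_chartSections _ ?_ ?_ ?_ ?_, 0, zero_mem _,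
      AddMonoidAlgebra.single (w - Pi.single (Sum.inr l) 1 - Pi.single (Sum.inr l) 1
        + Pi.single (Sum.inr (1 - l)) 1) (-1),
      single_mem_chartSections _ ?_ ?_ ?_ ?_, ?_⟩
    · simpa using hx
    · rw [hsum]; simp [hne.symm]; omega
    · simpa using hw (Sum.inl (1 - j))
    · simpa [hne, hne.symm] using hw1
    · simpa using hx
    · rw [hsum]; simp [hne.symm]; omega
    · simpa using hw (Sum.inl (1 - j))
    · simp [hne.symm]; omega
    · ext σ : 1
      have hE := laurent_euler_inr σ.2 l
      set a : Laurent := AddMonoidAlgebra.single (w - Pi.single (Sum.inr l) 1) 1 with ha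
      have h1 : AddMonoidAlgebra.single w (1 : ℂ) = a * lvar (Sum.inr l) := by
        simp [ha, lvar, AddMonoidAlgebra.single_mul_single]
      have h2 : AddMonoidAlgebra.single (w - Pi.single (Sum.inr l) 1) (e : ℂ) = (e : ℂ) • a := by
        simp [ha]
      have h3 : AddMonoidAlgebra.single (w - Pi.single (Sum.inr l) 1 - Pi.single (Sum.inr l) 1
          + Pi.single (Sum.inr (1 - l)) 1) (-1 : ℂ) * lvar (Sum.inr l) =
          -(a * lvar (Sum.inr (1 - l))) := by
        rw [ha, lvar, lvar, AddMonoidAlgebra.single_mul_single, AddMonoidAlgebra.single_mul_single,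
          ← AddMonoidAlgebra.single_neg]
        congr 1
        · abel
        · ring
      simp only [chartOp, LinearMap.comp_apply, LinearMap.add_apply, LinearMap.mulLeft_apply,
        Submodule.subtype_apply, h1, h2, h3, zero_mul, add_zero, smul_mul_assoc]
      rw [← mul_smul_comm, ← hE]
      ring
  · obtain rfl := eq_one_sub_of_ne hl
    refine ⟨0, zero_mem _, 0, zero_mem _, AddMonoidAlgebra.single (w - Pi.single (Sum.inr i) 1) 1,
      single_mem_chartSections _ ?_ ?_ ?_ ?_, ?_⟩
    · simpa using hx
    · rw [hsum]; simp [hne.symm]; omega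
    · simpa using hw (Sum.inl (1 - j))
    · simpa [hne, hne.symm] using hw1
    · ext σ : 1
      simp [chartOp, lvar, AddMonoidAlgebra.single_mul_single]

theorem single_mem_torusSections {d e : ℤ} {u : Idx → ℤ} (c : ℂ)
    (hx : u (Sum.inl 0) + u (Sum.inl 1) = d) (hy : u (Sum.inr 0) + u (Sum.inr 1) = e) :
    AddMonoidAlgebra.single u c ∈ torusSections d e := by
  rw [torusSections, AddMonoidAlgebra.mem_supported]
  refine (Finset.coe_subset.mpr Finsupp.support_single_subset).trans ?_
  simpa using ⟨hx, hy⟩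

/-- On the chart `U_{ij}` an operator multiplies the monomial `t ^ u` by `α + u_{1-i} β + u_{1-j}
γ`, where `α = A`, `β = B x_i / x_{1-i}` and `γ = C y_j / y_{1-j}`.  The conditions on `A`, `B`,
`C` bound the exponents `w` of the Laurent polynomials `α`, `β`, `γ`, given here by their
coefficients. -/
theorem exists_symbol {d e m n : ℤ} {D : torusSections d e →ₗ[ℂ] Laurent}
    (hD : D ∈ globalOps d e m n) (i j : Fin 2) : ∃ α β γ : (Idx → ℤ) → ℂ,
      (∀ w, α w ≠ 0 → 0 ≤ w (Sum.inl (1 - i)) ∧ 0 ≤ w (Sum.inr (1 - j))) ∧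
      (∀ w, β w ≠ 0 → -1 ≤ w (Sum.inl (1 - i)) ∧ 0 ≤ w (Sum.inr (1 - j))) ∧
      (∀ w, γ w ≠ 0 → 0 ≤ w (Sum.inl (1 - i)) ∧ -1 ≤ w (Sum.inr (1 - j))) ∧
      (∀ w, (α w ≠ 0 ∨ β w ≠ 0 ∨ γ w ≠ 0) →
        w (Sum.inl 0) + w (Sum.inl 1) = m ∧ w (Sum.inr 0) + w (Sum.inr 1) = n) ∧
      ∀ (u : Idx → ℤ) (hu : AddMonoidAlgebra.single u (1 : ℂ) ∈ torusSections d e) (w : Idx → ℤ),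
        (D ⟨_, hu⟩).coeff (w + u) =
          α w + u (Sum.inl (1 - i)) * β w + u (Sum.inr (1 - j)) * γ w := by
  obtain ⟨A, hA, B, hB, C, hC, rfl⟩ := hD i j
  rw [chartSections, AddMonoidAlgebra.mem_supported] at hA hB hC
  have hnei : (Sum.inl i : Idx) ≠ Sum.inl (1 - i) := fun h => one_sub_ne i (Sum.inl.inj h).symm
  have hnej : (Sum.inr j : Idx) ≠ Sum.inr (1 - j) := fun h => one_sub_ne j (Sum.inr.inj h).symm
  have hA' (w : Idx → ℤ) (h : A.coeff w ≠ 0) := hA (Finsupp.mem_support_iff.mpr h)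
  have hB' (w : Idx → ℤ) (h : B.coeff w ≠ 0) := hB (Finsupp.mem_support_iff.mpr h)
  have hC' (w : Idx → ℤ) (h : C.coeff w ≠ 0) := hC (Finsupp.mem_support_iff.mpr h)
  have hx (v : Idx → ℤ) : v (Sum.inl 0) + v (Sum.inl 1) =
      v (Sum.inl i) + v (Sum.inl (1 - i)) := by
    fin_cases i <;> simp [add_comm]
  have hy (v : Idx → ℤ) : v (Sum.inr 0) + v (Sum.inr 1) = v (Sum.inr j) + v (Sum.inr (1 - j)) := by
    fin_cases j <;> simp [add_comm]
  simp only [Set.mem_ofPred_eq, hx, hy] at hA' hB' hC'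
  refine ⟨fun w => A.coeff w,
    fun w => B.coeff (w - Pi.single (Sum.inl i) 1 + Pi.single (Sum.inl (1 - i)) 1),
    fun w => C.coeff (w - Pi.single (Sum.inr j) 1 + Pi.single (Sum.inr (1 - j)) 1),
    fun w h => (hA' w h).2, fun w h => ?_, fun w h => ?_, fun w h => ?_, fun u hu w => ?_⟩
  · have := hB' _ h
    simp [hnei.symm] at this
    omega
  · have := hC' _ h
    simp [hnej.symm] at this
    omega
  · rw [hx, hy]
    rcases h with h | h | h
    · exact (hA' w h).1
    · have := hB' _ h
      simp [hnei, hnei.symm] at this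
      omega
    · have := hC' _ h
      simp [hnej, hnej.symm] at this
      omega
  · simp only [chartOp, LinearMap.comp_apply, LinearMap.add_apply, LinearMap.mulLeft_apply,
      Submodule.subtype_apply, lderiv_single, mul_assoc, lvar, AddMonoidAlgebra.single_mul_single,
      AddMonoidAlgebra.coeff_add, Finsupp.add_apply, AddMonoidAlgebra.coeff_mul_single_apply]
    have h1 (s t : Idx) : w + u + -(Pi.single s 1 + (u - Pi.single t 1)) =
        w - Pi.single s 1 + Pi.single t (1 : ℤ) := by abel
    rw [h1, h1, add_neg_cancel_right]
    ring

/-- The global operators of `H⁰(Σ_L ⊗ 𝒪(-1, 0))` are combinations of `∂/∂x₀` and `∂/∂x₁`.  The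
symbols on different charts agree as functions of the exponents of the monomial they are applied
to, which leaves only the exponents `-e_{x₀}` and `-e_{x₁}`. -/
theorem globalOps_apply_single {d e : ℤ} {D : torusSections d e →ₗ[ℂ] Laurent}
    (hD : D ∈ globalOps d e (-1) 0) : ∃ b₀ b₁ : ℂ, ∀ (u : Idx → ℤ)
      (hu : AddMonoidAlgebra.single u (1 : ℂ) ∈ torusSections d e),
      D ⟨_, hu⟩ = b₀ • lderiv (Sum.inl 0) (AddMonoidAlgebra.single u 1) +
        b₁ • lderiv (Sum.inl 1) (AddMonoidAlgebra.single u 1) := by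
  obtain ⟨α, β, γ, hα, hβ, hγ, hdeg, h00⟩ := exists_symbol hD 0 0
  obtain ⟨α', β', γ', hα', hβ', hγ', hdeg', h10⟩ := exists_symbol hD 1 0
  obtain ⟨α'', β'', γ'', hα'', hβ'', hγ'', hdeg'', h01⟩ := exists_symbol hD 0 1
  simp only [sub_zero, sub_self, Fin.isValue] at *
  -- the monomials `x₀ ^ (d - v) x₁ ^ v y₀ ^ (e - t) y₁ ^ t`
  let u (v t : ℤ) : Idx → ℤ := Sum.elim ![d - v, v] ![e - t, t]
  have hu (v t : ℤ) : AddMonoidAlgebra.single (u v t) (1 : ℂ) ∈ torusSections d e :=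
    single_mem_torusSections _ (by simp [u]) (by simp [u])
  have e10 (v t : ℤ) (w : Idx → ℤ) : α w + v * β w + t * γ w =
      α' w + (d - v) * β' w + t * γ' w := by
    have h := (h00 _ (hu v t) w).symm.trans (h10 _ (hu v t) w)
    simpa [u] using h
  have e01 (v t : ℤ) (w : Idx → ℤ) : α w + v * β w + t * γ w =
      α'' w + v * β'' w + (e - t) * γ'' w := by
    have h := (h00 _ (hu v t) w).symm.trans (h01 _ (hu v t) w)
    simpa [u] using h
  have cβ (w : Idx → ℤ) : β' w = -β w := by
    have h1 := e10 0 0 w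
    have h2 := e10 1 0 w
    push_cast at h1 h2
    linear_combination h2 - h1
  have cγ (w : Idx → ℤ) : γ' w = γ w := by
    have h1 := e10 0 0 w
    have h2 := e10 0 1 w
    push_cast at h1 h2
    linear_combination h1 - h2
  have cα (w : Idx → ℤ) : α' w = α w + d * β w := by
    have h1 := e10 0 0 w
    rw [cβ, cγ] at h1
    push_cast at h1
    linear_combination -h1
  have cγ' (w : Idx → ℤ) : γ'' w = -γ w := by
    have h1 := e01 0 0 w
    have h2 := e01 0 1 w
    push_cast at h1 h2
    linear_combination h2 - h1
  have cβ' (w : Idx → ℤ) : β'' w = β w := by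
    have h1 := e01 0 0 w
    have h2 := e01 1 0 w
    push_cast at h1 h2
    linear_combination h1 - h2
  have zγ (w : Idx → ℤ) : γ w = 0 := by
    by_contra h
    have h1 := hγ w h
    have h2 := hγ' w (by rwa [cγ])
    have h3 := hdeg w (Or.inr (Or.inr h))
    omega
  have cα' (w : Idx → ℤ) : α'' w = α w := by
    have h1 := e01 0 0 w
    rw [cγ', zγ] at h1
    push_cast at h1
    linear_combination -h1
  -- the exponents of `x₀` and `x₁` in `β` are at least `-1` and add up to `-1`, those of `y₀` and
  -- `y₁` are nonnegative and add up to `0`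
  have key (w : Idx → ℤ) (h : β w ≠ 0) :
      w = -Pi.single (Sum.inl 0) 1 ∨ w = -Pi.single (Sum.inl 1) 1 := by
    have h1 := hβ w h
    have h2 := hβ' w (by rwa [cβ, neg_ne_zero])
    have h3 := hβ'' w (by rwa [cβ'])
    have h4 := hdeg w (Or.inr (Or.inl h))
    rcases (by omega : w (Sum.inl 0) = -1 ∨ w (Sum.inl 1) = -1) with h5 | h5
    · left
      ext (k | k) <;> fin_cases k <;> simp <;> omega
    · right
      ext (k | k) <;> fin_cases k <;> simp <;> omega
  have key' (w : Idx → ℤ) (h : α w ≠ 0) : β w ≠ 0 := by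
    intro h0
    have h1 := hα w h
    have h2 := hα' w (by rwa [cα, h0, mul_zero, add_zero])
    have h4 := hdeg w (Or.inl h)
    omega
  have a0 : α (-Pi.single (Sum.inl 0) 1) = -d * β (-Pi.single (Sum.inl 0) 1) := by
    have h : α' (-Pi.single (Sum.inl 0) 1) = 0 := by
      by_contra h
      have := (hα' _ h).1
      simp at this
    rw [cα] at h
    linear_combination h
  have a1 : α (-Pi.single (Sum.inl 1) 1) = 0 := by
    by_contra h
    have := (hα _ h).1
    simp at this
  refine ⟨-β (-Pi.single (Sum.inl 0) 1), β (-Pi.single (Sum.inl 1) 1), fun u hu => ?_⟩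
  ext t
  obtain ⟨w, rfl⟩ : ∃ w, t = w + u := ⟨t - u, by abel⟩
  have hsum : u (Sum.inl 0) + u (Sum.inl 1) = d :=
    (AddMonoidAlgebra.mem_supported.mp hu (Finsupp.mem_support_iff.mpr (by simp))).1
  have hne : (-Pi.single (Sum.inl 0) 1 : Idx → ℤ) ≠ -Pi.single (Sum.inl 1) 1 := by
    intro h
    have := congrFun h (Sum.inl 0)
    simp at this
  have hiff (s : Idx) : u - Pi.single s 1 = w + u ↔ w = -Pi.single s (1 : ℤ) := by
    constructor <;> intro h
    · rw [eq_sub_of_add_eq h.symm]; abel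
    · rw [h]; abel
  rw [h00 u hu w, zγ, mul_zero, add_zero, lderiv_single, lderiv_single,
    AddMonoidAlgebra.coeff_add, Finsupp.add_apply, AddMonoidAlgebra.coeff_smul,
    AddMonoidAlgebra.coeff_smul, Finsupp.smul_apply, Finsupp.smul_apply,
    AddMonoidAlgebra.coeff_single, AddMonoidAlgebra.coeff_single, Finsupp.single_apply,
    Finsupp.single_apply]
  simp only [hiff, mul_one, smul_eq_mul]
  by_cases h0 : β w = 0
  · rw [h0, not_not.mp (mt (key' w) (not_not.mpr h0))]
    split_ifs with h1 h2 h2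
    · exact absurd (h1.symm.trans h2) hne
    · rw [← h1, h0]; simp
    · rw [← h2, h0]; simp
    · simp
  · rcases key w h0 with rfl | rfl
    · rw [if_pos rfl, if_neg hne, a0, ← hsum]
      push_cast
      ring
    · rw [if_pos rfl, if_neg hne.symm, a1]
      ring

theorem single_mem_torusSections_of_coeff_ne_zero {d e : ℕ} (F : bigraded (d, e)) (u : Idx →₀ ℕ)
    (hu : coeff u (F : S) ≠ 0) :
    AddMonoidAlgebra.single (fun s => (u s : ℤ)) (1 : ℂ) ∈ torusSections (d : ℤ) (e : ℤ) := by
  obtain ⟨h1, h2⟩ := degree_eq_of_mem_bigraded F.2 hu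
  exact single_mem_torusSections _ (by exact_mod_cast h1) (by exact_mod_cast h2)

theorem globalOps_apply_asSection {d e : ℕ} (F : bigraded (d, e))
    {D : torusSections d e →ₗ[ℂ] Laurent} (hD : D ∈ globalOps d e (-1) 0) :
    ∃ b₀ b₁ : ℂ, D (asSection F) = toLaurent
      (b₀ • pderiv (Sum.inl 0) (F : S) + b₁ • pderiv (Sum.inl 1) (F : S)) := by
  obtain ⟨b₀, b₁, h⟩ := globalOps_apply_single hD
  refine ⟨b₀, b₁, ?_⟩
  have hF : asSection F = ∑ u ∈ (F : S).support.attach, coeff u (F : S) •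
      (⟨_, single_mem_torusSections_of_coeff_ne_zero F u (mem_support_iff.mp u.2)⟩ :
        torusSections (d : ℤ) (e : ℤ)) := by
    apply Subtype.ext
    have hsum : toLaurent (F : S) = ∑ u ∈ (F : S).support, coeff u (F : S) •
        AddMonoidAlgebra.single (fun s => (u s : ℤ)) (1 : ℂ) := by
      conv_lhs => rw [(F : S).as_sum, map_sum]
      exact Finset.sum_congr rfl fun u _ => by simp [toLaurent_monomial]
    rw [Submodule.coe_sum]
    exact hsum.trans (Finset.sum_attach _ fun u : Idx →₀ ℕ => coeff u (F : S) •
      AddMonoidAlgebra.single (fun s => (u s : ℤ)) (1 : ℂ)).symm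
  have hF' : toLaurent (F : S) = ∑ u ∈ (F : S).support.attach, coeff u (F : S) •
      AddMonoidAlgebra.single (fun s => ((u : Idx →₀ ℕ) s : ℤ)) (1 : ℂ) := by
    have := congrArg Subtype.val hF
    rwa [Submodule.coe_sum] at this
  rw [map_add, map_smul, map_smul, toLaurent_pderiv, toLaurent_pderiv, hF', hF, map_sum,
    map_sum, map_sum, Finset.smul_sum, Finset.smul_sum, ← Finset.sum_add_distrib]
  refine Finset.sum_congr rfl fun u _ => ?_
  rw [map_smul, map_smul, map_smul, h, smul_add, smul_comm b₀, smul_comm b₁]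

theorem mem_jacobian_iff {d e : ℕ} (F : bigraded (d, e)) {a b : ℕ} {G : S} :
    G ∈ jacobian F a b ↔ G ∈ bigraded (a, b) ∧
      ∃ D ∈ globalOps d e ((a : ℤ) - d) ((b : ℤ) - e), D (asSection F) = toLaurent G := Iff.rfl

theorem jacobian_inl_eq_span {d e : ℕ} (F : bigraded (d + 1, e)) :
    jacobian F d e = Submodule.span ℂ
      {pderiv (Sum.inl 0) (F : S), pderiv (Sum.inl 1) (F : S)} := by
  have hm : ((d : ℤ) - (d + 1 : ℕ)) = -1 := by push_cast; ring
  apply le_antisymm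
  · intro G hG
    obtain ⟨-, D, hD, hDG⟩ := (mem_jacobian_iff F).mp hG
    rw [hm, sub_self] at hD
    obtain ⟨b₀, b₁, h⟩ := globalOps_apply_asSection F hD
    rw [hDG] at h
    rw [toLaurent_injective h]
    exact Submodule.mem_span_pair.mpr ⟨b₀, b₁, rfl⟩
  · rw [Submodule.span_le]
    have key (k : Fin 2) : pderiv (Sum.inl k) (F : S) ∈ jacobian F d e := by
      refine (mem_jacobian_iff F).mpr ⟨pderiv_inl_mem F.2 k, _,
        mul_lderiv_inl_mem_globalOps (w := 0) (by simp) (by simp) (by simp) k, ?_⟩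
      rw [toLaurent_pderiv]
      exact one_mul _
    rintro _ (rfl | rfl)
    exacts [key 0, key 1]

theorem X_mul_pderiv_inl_mem_jacobian {d e : ℕ} (F : bigraded (d + 1, e)) (k l : Fin 2) :
    X (Sum.inl k) * pderiv (Sum.inl l) (F : S) ∈ jacobian F (d + 1) e := by
  have hmem : X (Sum.inl k) * pderiv (Sum.inl l) (F : S) ∈ bigraded (1 + d, 0 + e) :=
    IsWeightedHomogeneous.mul (X_inl_mem k) (pderiv_inl_mem F.2 l)
  rw [add_comm 1, zero_add] at hmem
  refine (mem_jacobian_iff F).mpr ⟨hmem, _, mul_lderiv_inl_mem_globalOps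
    (w := Pi.single (Sum.inl k) 1) ?_ ?_ ?_ l, ?_⟩
  · intro s
    rw [Pi.single_apply]
    split_ifs <;> simp
  · fin_cases k <;> simp
  · simp
  · rw [map_mul, toLaurent_pderiv, toLaurent, aeval_X]
    rfl

theorem X_mul_pderiv_inr_mem_jacobian {d e : ℕ} (F : bigraded (d, e + 1)) (k l : Fin 2) :
    X (Sum.inr k) * pderiv (Sum.inr l) (F : S) ∈ jacobian F d (e + 1) := by
  have hmem : X (Sum.inr k) * pderiv (Sum.inr l) (F : S) ∈ bigraded (0 + d, 1 + e) :=
    IsWeightedHomogeneous.mul (X_inr_mem k) (pderiv_inr_mem F.2 l)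
  rw [add_comm 1, zero_add] at hmem
  refine (mem_jacobian_iff F).mpr ⟨hmem, _, mul_lderiv_inr_mem_globalOps
    (w := Pi.single (Sum.inr k) 1) ?_ ?_ ?_ l, ?_⟩
  · intro s
    rw [Pi.single_apply]
    split_ifs <;> simp
  · simp
  · fin_cases k <;> simp
  · rw [map_mul, toLaurent_pderiv, toLaurent, aeval_X]
    rfl

/-! ### The pencil spanned by the two partial derivatives -/

theorem euler_inl_sub {a b : ℕ} {G : S} (hG : G ∈ bigraded (a, b)) (i : Fin 2) :
    X (Sum.inl i) * pderiv (Sum.inl i) G +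
      X (Sum.inl (1 - i)) * pderiv (Sum.inl (1 - i)) G = (a : S) * G := by
  fin_cases i
  exacts [euler_inl hG, (add_comm _ _).trans (euler_inl hG)]

theorem euler_inr_sub {a b : ℕ} {G : S} (hG : G ∈ bigraded (a, b)) (j : Fin 2) :
    X (Sum.inr j) * pderiv (Sum.inr j) G +
      X (Sum.inr (1 - j)) * pderiv (Sum.inr (1 - j)) G = (b : S) * G := by
  fin_cases j
  exacts [euler_inr hG, (add_comm _ _).trans (euler_inr hG)]

theorem pderiv_inl_ne_zero {d e : ℕ} {F : S} (hF : F ∈ bigraded (d + 1, e + 1))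
    (hirr : Irreducible F) (k : Fin 2) : pderiv (Sum.inl k) F ≠ 0 := by
  intro h0
  have heul : X (Sum.inl (1 - k)) * pderiv (Sum.inl (1 - k)) F = ((d + 1 : ℕ) : S) * F := by
    have h := euler_inl_sub hF k
    rwa [h0, mul_zero, zero_add] at h
  have hdF : ((d + 1 : ℕ) : S) * F ≠ 0 :=
    mul_ne_zero (Nat.cast_ne_zero.mpr d.succ_ne_zero) hirr.ne_zero
  rcases hirr.prime.dvd_or_dvd (Dvd.intro_left _ heul.symm) with h | h
  · exact not_dvd_of_degree_lt hF (X_inl_mem (1 - k)) (X_ne_zero _) (by omega) h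
  · refine not_dvd_of_degree_lt hF (pderiv_inl_mem hF (1 - k)) ?_ (by omega) h
    intro h1
    rw [h1, mul_zero] at heul
    exact hdF heul.symm

theorem pderiv_inr_ne_zero {d e : ℕ} {F : S} (hF : F ∈ bigraded (d + 1, e + 1))
    (hirr : Irreducible F) (k : Fin 2) : pderiv (Sum.inr k) F ≠ 0 := by
  intro h0
  have heul : X (Sum.inr (1 - k)) * pderiv (Sum.inr (1 - k)) F = ((e + 1 : ℕ) : S) * F := by
    have h := euler_inr_sub hF k
    rwa [h0, mul_zero, zero_add] at h
  have hdF : ((e + 1 : ℕ) : S) * F ≠ 0 :=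
    mul_ne_zero (Nat.cast_ne_zero.mpr e.succ_ne_zero) hirr.ne_zero
  rcases hirr.prime.dvd_or_dvd (Dvd.intro_left _ heul.symm) with h | h
  · exact not_dvd_of_degree_lt hF (X_inr_mem (1 - k)) (X_ne_zero _) (by omega) h
  · refine not_dvd_of_degree_lt hF (pderiv_inr_mem hF (1 - k)) ?_ (by omega) h
    intro h1
    rw [h1, mul_zero] at heul
    exact hdF heul.symm

theorem not_dvd_pderiv_inl {d e : ℕ} {F : S} (hF : F ∈ bigraded (d + 1, e + 1))
    (hirr : Irreducible F) (k : Fin 2) : ¬ F ∣ pderiv (Sum.inl k) F :=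
  not_dvd_of_degree_lt hF (pderiv_inl_mem hF k) (pderiv_inl_ne_zero hF hirr k) (by omega)

theorem not_dvd_pderiv_inr {d e : ℕ} {F : S} (hF : F ∈ bigraded (d + 1, e + 1))
    (hirr : Irreducible F) (k : Fin 2) : ¬ F ∣ pderiv (Sum.inr k) F :=
  not_dvd_of_degree_lt hF (pderiv_inr_mem hF k) (pderiv_inr_ne_zero hF hirr k) (by omega)

/-- The combination `c₀ F_{x₀} + c₁ F_{x₁}`. -/
noncomputable def pderivComb (F : S) : (Fin 2 → ℂ) →ₗ[ℂ] S where
  toFun c := c 0 • pderiv (Sum.inl 0) F + c 1 • pderiv (Sum.inl 1) F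
  map_add' c c' := by simp only [Pi.add_apply, add_smul]; abel
  map_smul' r c := by
    simp only [Pi.smul_apply, smul_eq_mul, mul_smul, RingHom.id_apply, smul_add]

theorem pderivComb_apply (F : S) (c : Fin 2 → ℂ) : pderivComb F c =
    c 0 • pderiv (Sum.inl 0) F + c 1 • pderiv (Sum.inl 1) F := rfl

theorem pderivComb_mem {d e : ℕ} {F : S} (hF : F ∈ bigraded (d + 1, e)) (c : Fin 2 → ℂ) :
    pderivComb F c ∈ bigraded (d, e) :=
  add_mem (Submodule.smul_mem _ _ (pderiv_inl_mem hF 0))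
    (Submodule.smul_mem _ _ (pderiv_inl_mem hF 1))

/-- The linear form `c₁ x₀ - c₀ x₁`, the moving part of `c₀ F_{x₀} + c₁ F_{x₁}` on `{F = 0}`. -/
noncomputable def dualForm (c : Fin 2 → ℂ) : S :=
  C (c 1) * X (Sum.inl 0) - C (c 0) * X (Sum.inl 1)

theorem dualForm_mem (c : Fin 2 → ℂ) : dualForm c ∈ bigraded (1, 0) :=
  IsWeightedHomogeneous.sub (IsWeightedHomogeneous.C_mul (X_inl_mem 0) _)
    (IsWeightedHomogeneous.C_mul (X_inl_mem 1) _)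

theorem evalAt_dualForm (p : Surf) (c : Fin 2 → ℂ) :
    evalAt p (dualForm c) = c 1 * p.1.rep 0 - c 0 * p.1.rep 1 := by
  simp [dualForm, evalAt, coords]

theorem X_mul_pderivComb {d e : ℕ} {F : S} (hF : F ∈ bigraded (d + 1, e)) (c : Fin 2 → ℂ)
    (i : Fin 2) : ∃ r : S, X (Sum.inl i) * pderivComb F c =
      dualForm c * ((-1) ^ (i : ℕ) * pderiv (Sum.inl (1 - i)) F) + r * F := by
  have h := euler_inl hF
  simp only [pderivComb_apply, dualForm, smul_eq_C_mul]
  fin_cases i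
  · refine ⟨C (c 0) * ((d + 1 : ℕ) : S), ?_⟩
    simp
    push_cast at h
    linear_combination C (c 0) * h
  · refine ⟨C (c 1) * ((d + 1 : ℕ) : S), ?_⟩
    simp
    push_cast at h
    linear_combination C (c 1) * h

/-- The number `r` is the multiplicity of `p` in the base divisor of the pencil. -/
theorem exists_ordAt_pderivComb {d e : ℕ} {F : S} (hF : F ∈ bigraded (d + 1, e + 1))
    (hirr : Irreducible F) (hsm : IsSmooth F) {p : Surf} (hp : p ∈ Z F) :
    ∃ r : ℕ, ramIndexSnd F p = (r : ℕ∞) + 1 ∧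
      (∀ c : Fin 2 → ℂ, (r : ℕ∞) ≤ ordAt F p (pderivComb F c) ∧
        ((r : ℕ∞) < ordAt F p (pderivComb F c) ↔ c 1 * p.1.rep 0 - c 0 * p.1.rep 1 = 0)) ∧
      (r ≠ 0 → evalAt p (pderiv (Sum.inl 0) F) = 0) := by
  obtain ⟨Φ, hΦ, hΦF, hord, hne, i, hi, hram⟩ := exists_parametrization hF hirr hsm hp
  obtain ⟨r, hr⟩ := ENat.ne_top_iff_exists.mp (mt PowerSeries.order_eq_top.mp
    (hne (pderiv_inl_mem hF (1 - i)) (not_dvd_pderiv_inl hF hirr (1 - i))))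
  refine ⟨r, by rw [ramIndexSnd, hord (lineThrough_mem p.2), hram, hr], fun c => ?_, fun h => ?_⟩
  · obtain ⟨q, hq⟩ := X_mul_pderivComb hF c i
    have h1 := congrArg (fun G => (Φ G).order) hq
    have hX : (Φ (X (Sum.inl i))).order = 0 := PowerSeries.order_zero_of_unit
      (isUnit_of_evalAt_ne_zero hΦ (by rwa [evalAt_X_inl]))
    have hs : (Φ ((-1) ^ (i : ℕ))).order = 0 := PowerSeries.order_zero_of_unit
      (isUnit_of_evalAt_ne_zero hΦ (by simp))
    simp only [map_add, map_mul Φ, hΦF, mul_zero, add_zero, PowerSeries.order_mul, hX, hs,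
      zero_add, ← hr] at h1
    rw [hord (pderivComb_mem hF c), h1, ← evalAt_dualForm, ← hΦ,
      ← PowerSeries.order_ne_zero_iff_constCoeff_eq_zero, ← pos_iff_ne_zero]
    refine ⟨le_add_self, ?_⟩
    exact (by rw [zero_add] : (r : ℕ∞) < _ ↔ 0 + (r : ℕ∞) < _).trans
      (ENat.add_lt_add_iff_right (ENat.natCast_ne_top r))
  · refine euler_fst_at hF hp hi ?_ 0
    rw [← hΦ, ← PowerSeries.order_ne_zero_iff_constCoeff_eq_zero, ← hr]
    exact_mod_cast h

theorem resTo_eq_iff {F : S} {J : Submodule ℂ S} {s t : J} :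
    resTo F J s = resTo F J t ↔ F ∣ (s : S) - t := by
  rw [← Ideal.mem_span_singleton, ← Ideal.Quotient.eq, Subtype.ext_iff]
  rfl

theorem jacobian_eq_range {d e : ℕ} (F : bigraded (d + 1, e)) :
    jacobian F d e = LinearMap.range (pderivComb (F : S)) := by
  rw [jacobian_inl_eq_span]
  ext G
  rw [Submodule.mem_span_pair, LinearMap.mem_range]
  constructor
  · rintro ⟨a, b, rfl⟩
    exact ⟨![a, b], by simp [pderivComb_apply]⟩
  · rintro ⟨c, rfl⟩
    exact ⟨c 0, c 1, rfl⟩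

theorem eq_zero_of_dvd_pderivComb {d e : ℕ} {F : S} (hF : F ∈ bigraded (d + 1, e + 1))
    (hirr : Irreducible F) {c : Fin 2 → ℂ} (h : F ∣ pderivComb F c) : c = 0 := by
  by_contra hc
  obtain ⟨r, hr⟩ := X_mul_pderivComb hF c 0
  have h1 : F ∣ dualForm c * pderiv (Sum.inl 1) F := by
    have h2 : dualForm c * pderiv (Sum.inl 1) F = X (Sum.inl 0) * pderivComb F c - r * F := by
      rw [hr]; simp
    rw [h2]
    exact dvd_sub (dvd_mul_of_dvd_right h _) (dvd_mul_left F r)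
  rcases hirr.prime.dvd_or_dvd h1 with h2 | h2
  · refine not_dvd_of_degree_lt hF (dualForm_mem c) (fun h0 => hc ?_) (by omega) h2
    have h3 := congrArg (aeval (Sum.elim ![1, 0] ![0, 0] : Idx → ℂ)) h0
    have h4 := congrArg (aeval (Sum.elim ![0, 1] ![0, 0] : Idx → ℂ)) h0
    simp [dualForm] at h3 h4
    funext k
    fin_cases k
    exacts [h4, h3]
  · exact not_dvd_pderiv_inl hF hirr 1 h2

theorem mk_rep_apply_eq_zero_iff {W : Type} [AddCommGroup W] [Module ℂ W] {f : Dual ℂ W}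
    (hf : f ≠ 0) (w : W) : (Projectivization.mk ℂ f hf).rep w = 0 ↔ f w = 0 := by
  obtain ⟨a, ha⟩ := Projectivization.exists_smul_eq_mk_rep ℂ f hf
  rw [← ha]
  show (a : ℂ) * f w = 0 ↔ _
  simp

/-- The nondegenerate pairing `(v, c) ↦ c₁ v₀ - c₀ v₁`: the value of `dualForm c` at `v`. -/
noncomputable def areaForm : (Fin 2 → ℂ) →ₗ[ℂ] Dual ℂ (Fin 2 → ℂ) :=
  LinearMap.mk₂ ℂ (fun v c => c 1 * v 0 - c 0 * v 1)
    (fun _ _ _ => by simp only [Pi.add_apply]; ring)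
    (fun _ _ _ => by simp only [Pi.smul_apply, smul_eq_mul]; ring)
    (fun _ _ _ => by simp only [Pi.add_apply]; ring)
    (fun _ _ _ => by simp only [Pi.smul_apply, smul_eq_mul]; ring)

theorem areaForm_apply (v c : Fin 2 → ℂ) : areaForm v c = c 1 * v 0 - c 0 * v 1 := rfl

theorem areaForm_injective : Function.Injective areaForm := by
  rw [injective_iff_map_eq_zero]
  intro v hv
  have h1 := LinearMap.congr_fun hv ![1, 0]
  have h2 := LinearMap.congr_fun hv ![0, 1]
  simp [areaForm_apply] at h1 h2
  funext k
  fin_cases k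
  exacts [h2, h1]

/-- The dual of the pencil is identified with `ℂ²` by evaluating the moving part at points of the
first factor. -/
theorem exists_dual_equiv {d e : ℕ} (F : bigraded (d + 1, e + 1)) (hirr : Irreducible (F : S)) :
    ∃ θ : (Fin 2 → ℂ) ≃ₗ[ℂ] Dual ℂ (restrict (F : S) (jacobian F d (e + 1))),
      ∀ (v c : Fin 2 → ℂ) (s : jacobian F d (e + 1)), (s : S) = pderivComb (F : S) c →
        θ v (resTo (F : S) _ s) = c 1 * v 0 - c 0 * v 1 := by
  let T₀ : (Fin 2 → ℂ) →ₗ[ℂ] restrict (F : S) (jacobian F d (e + 1)) :=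
    (resTo (F : S) _).comp ((pderivComb (F : S)).codRestrict (jacobian F d (e + 1)) fun c => by
      rw [jacobian_eq_range]; exact ⟨c, rfl⟩)
  have hinj : Function.Injective T₀ := by
    rw [injective_iff_map_eq_zero]
    intro c hc
    rw [← map_zero (resTo (F : S) (jacobian F d (e + 1)))] at hc
    have h := resTo_eq_iff.mp hc
    rw [Submodule.coe_zero, sub_zero] at h
    exact eq_zero_of_dvd_pderivComb F.2 hirr h
  have hT (c : Fin 2 → ℂ) (s : jacobian F d (e + 1)) (hs : (s : S) = pderivComb (F : S) c) :
      T₀ c = resTo (F : S) _ s :=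
    congrArg (resTo (F : S) _) (Subtype.ext hs.symm)
  have hsurj : Function.Surjective T₀ := by
    intro w
    obtain ⟨s, rfl⟩ := (res (F : S)).submoduleMap_surjective _ w
    obtain ⟨c, hc⟩ : (s : S) ∈ LinearMap.range (pderivComb (F : S)) := jacobian_eq_range F ▸ s.2
    exact ⟨c, hT c s hc.symm⟩
  let T := LinearEquiv.ofBijective T₀ ⟨hinj, hsurj⟩
  let B := LinearMap.linearEquivOfInjective areaForm areaForm_injective
    (Subspace.dual_finrank_eq (K := ℂ) (V := Fin 2 → ℂ)).symm
  refine ⟨B.trans T.dualMap.symm, fun v c s hs => ?_⟩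
  rw [← hT c s hs]
  have h1 : (T.dualMap ((B.trans T.dualMap.symm) v)) c = areaForm v c := by
    rw [LinearEquiv.trans_apply, LinearEquiv.apply_symm_apply]
    rfl
  exact h1

theorem exists_baseDivisor {d e : ℕ} (F : bigraded (d + 1, e + 1)) (hirr : Irreducible (F : S))
    (hsm : IsSmooth (F : S)) : ∃ R : EffDiv (F : S),
      IsBaseDivisor (F : S) (jacobian F d (e + 1)) R ∧
      IsRamificationDivisorSnd (F : S) R ∧
      ∃ θ : (Fin 2 → ℂ) ≃ₗ[ℂ] Dual ℂ (restrict (F : S) (jacobian F d (e + 1))),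
        IsInducedMap (F : S) (jacobian F d (e + 1)) R
          (fun p => Projectivization.map θ.toLinearMap θ.injective p.1.1) := by
  choose r hram hcomb hzero using fun p : Z (F : S) => exists_ordAt_pderivComb F.2 hirr hsm p.2
  have hfin : (Function.support r).Finite := by
    refine ((finite_common_zeros hirr (not_dvd_pderiv_inl F.2 hirr 0) F.2
      (pderiv_inl_mem F.2 0)).preimage Subtype.val_injective.injOn).subset ?_
    exact fun p hp => ⟨p.2, hzero p hp⟩
  obtain ⟨θ, hθ⟩ := exists_dual_equiv F hirr
  refine ⟨Finsupp.ofSupportFinite r hfin, fun p => ?_, hram, θ, fun p s => ?_⟩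
  · refine le_antisymm (le_iInf₂ fun s hs => ?_) ?_
    · rw [jacobian_eq_range] at hs
      obtain ⟨c, rfl⟩ := hs
      exact (hcomb p c).1
    · obtain ⟨c, hc⟩ : ∃ c : Fin 2 → ℂ, c 1 * p.1.1.rep 0 - c 0 * p.1.1.rep 1 ≠ 0 := by
        obtain ⟨k, hk⟩ := exists_rep_ne_zero p.1.1
        fin_cases k
        · exact ⟨![0, 1], by simpa using hk⟩
        · exact ⟨![1, 0], by simpa using hk⟩
      refine (iInf₂_le (pderivComb (F : S) c) (by rw [jacobian_eq_range]; exact ⟨c, rfl⟩)).trans ?_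
      exact not_lt.mp (mt (hcomb p c).2.mp hc)
  · obtain ⟨c, hc⟩ : (s : S) ∈ LinearMap.range (pderivComb (F : S)) := jacobian_eq_range F ▸ s.2
    have h1 : Projectivization.map θ.toLinearMap θ.injective p.1.1 =
        Projectivization.mk ℂ (θ p.1.1.rep) (by simpa using p.1.1.rep_nonzero) := by
      conv_lhs => rw [← p.1.1.mk_rep]
      rfl
    show (Projectivization.map θ.toLinearMap θ.injective p.1.1).rep _ = 0 ↔ (r p : ℕ∞) < _
    rw [h1, mk_rep_apply_eq_zero_iff, hθ _ c s hc.symm, ← hc]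
    exact (hcomb p c).2.symm

/-! ### The base point free linear system and its map -/

/-- By the Nullstellensatz a form that vanishes on `Z` is divisible by `F`.  The form is multiplied
by `x₀ y₀` in order to find a zero of `F` in affine 4-space with both coordinate blocks nonzero. -/
theorem exists_point_evalAt_ne_zero {a b a' b' : ℕ} {F G : S} (hirr : Irreducible F)
    (hF : F ∈ bigraded (a, b)) (hab : 1 < a + b) (hG : G ∈ bigraded (a', b')) (hFG : ¬ F ∣ G) :
    ∃ p ∈ Z F, evalAt p G ≠ 0 := by
  have hndvd : ¬ F ∣ X (Sum.inl 0) * X (Sum.inr 0) * G := by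
    intro h
    rcases hirr.prime.dvd_or_dvd h with h | h
    · rcases hirr.prime.dvd_or_dvd h with h | h
      · exact not_dvd_of_degree_lt hF (X_inl_mem 0) (X_ne_zero _) (by omega) h
      · exact not_dvd_of_degree_lt hF (X_inr_mem 0) (X_ne_zero _) (by omega) h
    · exact hFG h
  have hprime : (Ideal.span {F}).IsPrime :=
    (Ideal.span_singleton_prime hirr.ne_zero).mpr hirr.prime
  have hvan := MvPolynomial.IsPrime.vanishingIdeal_zeroLocus (K := ℂ) (Ideal.span {F})
  rw [← Ideal.mem_span_singleton, ← hvan, mem_vanishingIdeal_iff] at hndvd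
  push Not at hndvd
  obtain ⟨v, hv, hne⟩ := hndvd
  have hvF : aeval v F = 0 := hv F (Ideal.mem_span_singleton_self F)
  rw [map_mul, map_mul, aeval_X, aeval_X] at hne
  have hx : (fun k => v (Sum.inl k)) ≠ 0 :=
    fun h => left_ne_zero_of_mul (left_ne_zero_of_mul hne) (congrFun h 0)
  have hy : (fun k => v (Sum.inr k)) ≠ 0 :=
    fun h => right_ne_zero_of_mul (left_ne_zero_of_mul hne) (congrFun h 0)
  obtain ⟨r, hr⟩ := Projectivization.exists_smul_eq_mk_rep ℂ _ hx
  obtain ⟨s, hs⟩ := Projectivization.exists_smul_eq_mk_rep ℂ _ hy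
  let p : Surf := (Projectivization.mk ℂ _ hx, Projectivization.mk ℂ _ hy)
  have hp : coords p = scale (r : ℂ) (s : ℂ) v := by
    funext t
    rcases t with k | k
    exacts [(congrFun hr k).symm, (congrFun hs k).symm]
  refine ⟨p, ?_, ?_⟩
  · show aeval (coords p) F = 0
    rw [hp, aeval_scale hF, hvF, mul_zero]
  · show aeval (coords p) G ≠ 0
    rw [hp, aeval_scale hG]
    exact mul_ne_zero (mul_ne_zero (pow_ne_zero _ r.ne_zero) (pow_ne_zero _ s.ne_zero))
      (right_ne_zero_of_mul hne)

/-- Evaluation of sections at the chosen coordinates of `p ∈ Z`, a linear functional on `J|_Z`. -/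
noncomputable def evalRestrict {F : S} (J : Submodule ℂ S) (p : Z F) : Dual ℂ (restrict F J) :=
  (Ideal.Quotient.liftₐ (Ideal.span {F}) (evalAt p) fun a ha => by
    obtain ⟨b, rfl⟩ := Ideal.mem_span_singleton.mp ha
    rw [map_mul, show evalAt p F = 0 from p.2, zero_mul]).toLinearMap.comp
    (restrict F J).subtype

theorem evalRestrict_resTo {F : S} (J : Submodule ℂ S) (p : Z F) (s : J) :
    evalRestrict J p (resTo F J s) = evalAt p (s : S) := rfl

theorem mk_eq_of_proportional {q : P1} {v : Fin 2 → ℂ} (hv : v ≠ 0) {r : ℂ}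
    (h : ∀ k, v k = r * q.rep k) : q = Projectivization.mk ℂ v hv := by
  conv_lhs => rw [← q.mk_rep]
  rw [eq_comm, Projectivization.mk_eq_mk_iff']
  exact ⟨r, funext fun k => (h k).symm⟩

theorem isBasePointFree_jacobian {d e : ℕ} (F : bigraded (d + 1, e + 1))
    (hsm : IsSmooth (F : S)) : IsBasePointFree (F : S) (jacobian F (d + 1) (e + 1)) := by
  intro p hp
  obtain ⟨k | k, hk⟩ := hsm p hp
  · obtain ⟨i, hi⟩ := exists_rep_ne_zero p.1
    refine ⟨_, X_mul_pderiv_inl_mem_jacobian F i k, ?_⟩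
    rw [map_mul, evalAt_X_inl]
    exact mul_ne_zero hi hk
  · obtain ⟨j, hj⟩ := exists_rep_ne_zero p.2
    refine ⟨_, X_mul_pderiv_inr_mem_jacobian F j k, ?_⟩
    rw [map_mul, evalAt_X_inr]
    exact mul_ne_zero hj hk

theorem evalRestrict_ne_zero {F : S} {J : Submodule ℂ S} (hJ : IsBasePointFree F J) (p : Z F) :
    evalRestrict J p ≠ 0 := by
  obtain ⟨s, hs, hne⟩ := hJ p p.2
  intro h
  exact hne ((evalRestrict_resTo J p ⟨s, hs⟩).symm.trans (LinearMap.congr_fun h _))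

theorem isMorphism_mk_evalRestrict {F : S} {J : Submodule ℂ S} {n : ℕ × ℕ} (hJn : J ≤ bigraded n)
    (hJ : IsBasePointFree F J) :
    IsMorphism
      fun p : Z F => Projectivization.mk ℂ (evalRestrict J p) (evalRestrict_ne_zero hJ p) := by
  intro p
  obtain ⟨σ, hσ⟩ := (resTo F J).exists_rightInverse_of_surjective
    (LinearMap.range_eq_top.mpr ((res F).submoduleMap_surjective J))
  have heq (q : Z F) : (evalAt q).toLinearMap.comp (J.subtype.comp σ) = evalRestrict J q := by
    ext w
    have h := evalRestrict_resTo J q (σ w)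
    rw [show resTo F J (σ w) = w from LinearMap.congr_fun hσ w] at h
    exact h.symm
  refine ⟨n, J.subtype.comp σ, fun w => hJn (σ w).2, ?_, fun q h => ?_⟩
  · rw [heq]
    exact evalRestrict_ne_zero hJ p
  · simp only [heq]

theorem isInducedMap_mk_evalRestrict {d e : ℕ} {F : S} (hF : F ∈ bigraded (d + 1, e + 1))
    (hirr : Irreducible F) (hsm : IsSmooth F) {J : Submodule ℂ S} {n : ℕ × ℕ}
    (hJn : J ≤ bigraded n) (hJ : IsBasePointFree F J) :
    IsInducedMap F J 0
      fun p : Z F => Projectivization.mk ℂ (evalRestrict J p) (evalRestrict_ne_zero hJ p) := by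
  intro p s
  obtain ⟨Φ, hΦ, -, hord, -⟩ := exists_parametrization hF hirr hsm p.2
  rw [mk_rep_apply_eq_zero_iff, evalRestrict_resTo, hord (hJn s.2), Finsupp.coe_zero,
    Pi.zero_apply, Nat.cast_zero, pos_iff_ne_zero, PowerSeries.order_ne_zero_iff_constCoeff_eq_zero,
    hΦ]

theorem exists_evalDual_X_resTo {F : S} {J : Submodule ℂ S} (hJ : IsBasePointFree F J)
    (p : Z F) : ∃ a : ℂ, a ≠ 0 ∧ ∀ s : J,
      evalDual (Projectivization.mk ℂ (evalRestrict J p) (evalRestrict_ne_zero hJ p))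
        (X (resTo F J s)) = a * evalAt p (s : S) := by
  obtain ⟨a, ha⟩ := Projectivization.exists_smul_eq_mk_rep ℂ (evalRestrict J p)
    (evalRestrict_ne_zero hJ p)
  refine ⟨a, a.ne_zero, fun s => ?_⟩
  rw [evalDual, aeval_X, ← ha]
  rfl

/-- The inverse is given on the locus where some `x_k F_{x_l}` and some `y_k F_{y_m}` are nonzero
by the ratios `x₀ F_{x_l} : x₁ F_{x_l}` and `y₀ F_{y_m} : y₁ F_{y_m}`. -/
theorem isBirationalOntoImage_mk_evalRestrict {d e : ℕ} {F : S}
    (hF : F ∈ bigraded (d + 1, e + 1)) (hirr : Irreducible F) {J : Submodule ℂ S} {n : ℕ × ℕ}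
    (hJn : J ≤ bigraded n) (hJ : IsBasePointFree F J)
    (hx : ∀ k l, X (Sum.inl k) * pderiv (Sum.inl l) F ∈ J)
    (hy : ∀ k l, X (Sum.inr k) * pderiv (Sum.inr l) F ∈ J) :
    IsBirationalOntoImage
      fun p : Z F => Projectivization.mk ℂ (evalRestrict J p) (evalRestrict_ne_zero hJ p) := by
  refine ⟨isMorphism_mk_evalRestrict hJn hJ, ?_⟩
  have hrep₀ := exists_evalDual_X_resTo hJ
  set φ := fun p : Z F => Projectivization.mk ℂ (evalRestrict J p) (evalRestrict_ne_zero hJ p)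
  let sx (k l : Fin 2) : restrict F J := resTo F J ⟨_, hx k l⟩
  let sy (k l : Fin 2) : restrict F J := resTo F J ⟨_, hy k l⟩
  have hrep (p : Z F) : ∃ a : ℂ, a ≠ 0 ∧
      (∀ k l, evalDual (φ p) (X (sx k l)) =
        a * evalAt p (pderiv (Sum.inl l) F) * p.1.1.rep k) ∧
      (∀ k l, evalDual (φ p) (X (sy k l)) =
        a * evalAt p (pderiv (Sum.inr l) F) * p.1.2.rep k) := by
    obtain ⟨a, ha, h⟩ := hrep₀ p
    refine ⟨a, ha, fun k l => (h ⟨_, hx k l⟩).trans ?_, fun k l => (h ⟨_, hy k l⟩).trans ?_⟩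
    · rw [map_mul, evalAt_X_inl]
      ring
    · rw [map_mul, evalAt_X_inr]
      ring
  let T : Set (MvPolynomial (restrict F J) ℂ) :=
    {P | ∃ k l k' l', P = X (sx k l) * X (sy k' l')}
  let V := {u ∈ Set.range φ | ∃ P ∈ T, evalDual u P ≠ 0}
  have hVx (u) (hu : u ∈ V) : ∃ l, (fun k => evalDual u (X (sx k l))) ≠ 0 := by
    obtain ⟨-, _, ⟨k, l, k', l', rfl⟩, h⟩ := hu
    rw [map_mul] at h
    exact ⟨l, fun h0 => left_ne_zero_of_mul h (congrFun h0 k)⟩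
  have hVy (u) (hu : u ∈ V) : ∃ l, (fun k => evalDual u (X (sy k l))) ≠ 0 := by
    obtain ⟨-, _, ⟨k, l, k', l', rfl⟩, h⟩ := hu
    rw [map_mul] at h
    exact ⟨l', fun h0 => right_ne_zero_of_mul h (congrFun h0 k')⟩
  have hfst (p : Z F) (l : Fin 2) (h : (fun k => evalDual (φ p) (X (sx k l))) ≠ 0) :
      p.1.1 = Projectivization.mk ℂ _ h := by
    obtain ⟨a, -, h1, -⟩ := hrep p
    exact mk_eq_of_proportional h fun k => h1 k l
  have hsnd (p : Z F) (l : Fin 2) (h : (fun k => evalDual (φ p) (X (sy k l))) ≠ 0) :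
      p.1.2 = Projectivization.mk ℂ _ h := by
    obtain ⟨a, -, -, h1⟩ := hrep p
    exact mk_eq_of_proportional h fun k => h1 k l
  have hinj (p q : Z F) (hp : φ p ∈ V) (hpq : φ q = φ p) : q.1 = p.1 := by
    obtain ⟨l, hl⟩ := hVx _ hp
    obtain ⟨l', hl'⟩ := hVy _ hp
    refine Prod.ext ?_ ?_
    · rw [hfst p l hl, hfst q l (hpq ▸ hl)]
      simp only [hpq]
    · rw [hsnd p l' hl', hsnd q l' (hpq ▸ hl')]
      simp only [hpq]
  have hprod : ¬ F ∣ pderiv (Sum.inl 0) F * pderiv (Sum.inr 0) F := fun h =>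
    (hirr.prime.dvd_or_dvd h).elim (not_dvd_pderiv_inl hF hirr 0) (not_dvd_pderiv_inr hF hirr 0)
  obtain ⟨p₀, hp₀, hne⟩ := exists_point_evalAt_ne_zero hirr hF (by omega)
    (IsWeightedHomogeneous.mul (pderiv_inl_mem hF 0) (pderiv_inr_mem hF 0)) hprod
  rw [map_mul] at hne
  classical
  let ψ (u : ℙ ℂ (Dual ℂ (restrict F J))) : Surf :=
    if h : ∃ p : Z F, φ p = u then h.choose.1 else p₀
  have hψ (p : Z F) (hp : φ p ∈ V) : ψ (φ p) = p := by
    have h : ∃ q : Z F, φ q = φ p := ⟨p, rfl⟩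
    simp only [ψ, dif_pos h]
    exact hinj p _ hp h.choose_spec
  refine ⟨V, ⟨T, ?_, rfl⟩, ⟨φ ⟨p₀, hp₀⟩, ⟨_, rfl⟩, ?_⟩, ψ, ?_, ?_, hψ⟩
  · rintro _ ⟨k, l, k', l', rfl⟩
    exact ⟨2, (isHomogeneous_X ℂ _).mul (isHomogeneous_X ℂ _)⟩
  · obtain ⟨i, hi⟩ := exists_rep_ne_zero p₀.1
    obtain ⟨j, hj⟩ := exists_rep_ne_zero p₀.2
    obtain ⟨a, ha, h1, h2⟩ := hrep ⟨p₀, hp₀⟩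
    refine ⟨_, ⟨i, 0, j, 0, rfl⟩, ?_⟩
    rw [map_mul, h1, h2]
    exact mul_ne_zero (mul_ne_zero (mul_ne_zero ha (left_ne_zero_of_mul hne)) hi)
      (mul_ne_zero (mul_ne_zero ha (right_ne_zero_of_mul hne)) hj)
  · intro v hv
    obtain ⟨l, hl⟩ := hVx v hv
    refine ⟨1, fun k => X (sx k l), fun k => isHomogeneous_X ℂ _, hl, fun u hu h => ?_⟩
    obtain ⟨q, rfl⟩ := hu.1
    show (ψ (φ q)).1 = _
    rw [hψ q hu]
    exact hfst q l h
  · intro v hv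
    obtain ⟨l, hl⟩ := hVy v hv
    refine ⟨1, fun k => X (sy k l), fun k => isHomogeneous_X ℂ _, hl, fun u hu h => ?_⟩
    obtain ⟨q, rfl⟩ := hu.1
    show (ψ (φ q)).2 = _
    rw [hψ q hu]
    exact hsnd q l h

end BiProj

theorem theorem4p2 (d e : ℕ) (hd : 2 ≤ d) (he : 2 ≤ e) (F : bigraded (d, e))
    (hirr : Irreducible (F : S)) (hsm : IsSmooth (F : S)) :
    (∃ R : EffDiv (F : S),
      IsBaseDivisor (F : S) (jacobian F (d - 1) e) R ∧
      IsRamificationDivisorSnd (F : S) R ∧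
      ∃ θ : (Fin 2 → ℂ) ≃ₗ[ℂ] Module.Dual ℂ (restrict (F : S) (jacobian F (d - 1) e)),
        IsInducedMap (F : S) (jacobian F (d - 1) e) R
          (fun p => Projectivization.map θ.toLinearMap θ.injective p.1.1)) ∧
    (IsBasePointFree (F : S) (jacobian F d e) ∧
      ∃ φ : Z (F : S) → Projectivization ℂ (Module.Dual ℂ (restrict (F : S) (jacobian F d e))),
        IsInducedMap (F : S) (jacobian F d e) 0 φ ∧ IsBirationalOntoImage φ) := by
  obtain ⟨d, rfl⟩ : ∃ d', d = d' + 1 := ⟨d - 1, by omega⟩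
  obtain ⟨e, rfl⟩ : ∃ e', e = e' + 1 := ⟨e - 1, by omega⟩
  have hJ := isBasePointFree_jacobian F hsm
  exact ⟨exists_baseDivisor F hirr hsm, hJ, _,
    isInducedMap_mk_evalRestrict F.2 hirr hsm inf_le_left hJ,
    isBirationalOntoImage_mk_evalRestrict F.2 hirr inf_le_left hJ
      (X_mul_pderiv_inl_mem_jacobian F) (X_mul_pderiv_inr_mem_jacobian F)⟩
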